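/- Let $K$ be a field, $S=K[x_1,\dots,x_n]$ the polynomial ring with its standard grading, and let $I,J\subseteq S$ be monomial ideals, that is, ideals generated by monomials. For a graded ideal $L\subseteq S$ let $\operatorname{projdim}(L)$ be the projective dimension of $L$ as an $S$-module, let $$M_i(L)=\max\{j\in\mathbb Z : \operatorname{Tor}_i^S(K,L)_j\neq 0\}\quad (i\ge 0),$$ where $K=S/(x_1,\dots,x_n)$, and let $$\operatorname{reg}(L)=\max\{M_i(L)-i : i\geq 0\}$$ be the regularity of $L$; here the maximum of the empty set is $-\infty$, so that $\operatorname{projdim}(0)=\operatorname{reg}(0)=-\infty$. Then (a) $\operatorname{projdim}(I\cap J)\leq \operatorname{projdim}(I)+\operatorname{projdim}(J)$; (b) $\operatorname{reg}(I\cap J)\leq \operatorname{reg}(I)+\operatorname{reg}(J)$. -/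

import Mathlib

universe u

namespace GradedTor

open MvPolynomial CategoryTheory

/-- `I ⊆ K[x₁, …, xₙ]` is a monomial ideal: it is generated by a set of monomials. -/
def IsMonomialIdeal {K : Type u} [Field K] {n : ℕ} (I : Ideal (MvPolynomial (Fin n) K)) : Prop :=
  ∃ A : Set (Fin n →₀ ℕ), I = Ideal.span ((fun a => monomial a (1 : K)) '' A)

/-- The degree `j` component of the graded free `S`-module `⨁_{b ∈ B} S(-deg b)`, where
`S = K[x₁, …, xₙ]` has the standard grading: the coordinate at `b` is a form of
degree `j - deg b`. -/
def homogeneousPart (K : Type u) [Field K] (n : ℕ) {B : Type u} (deg : B → ℤ) (j : ℤ) :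
    Submodule K (B →₀ MvPolynomial (Fin n) K) where
  carrier := {f | ∀ b : B, ∀ m ∈ (f b).support, ((Finsupp.degree m : ℕ) : ℤ) + deg b = j}
  zero_mem' := by intro b m hm; simp at hm
  add_mem' := by
    intro f g hf hg b m hm
    rw [Finsupp.add_apply] at hm
    rcases Finset.mem_union.1 (MvPolynomial.support_add hm) with h | h
    · exact hf b m h
    · exact hg b m h
  smul_mem' := by
    intro c f hf b m hm
    rw [Finsupp.smul_apply] at hm
    exact hf b m (MvPolynomial.support_smul hm)

/-- A complex `⋯ → F₂ → F₁ → F₀` of graded free modules `Fᵢ = ⨁_{b ∈ Bᵢ} S(-deg b)` over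
`S = K[x₁, …, xₙ]` with differentials of degree `0`; `d i` is the map `Fᵢ₊₁ → Fᵢ`. -/
structure GradedFreeComplex (K : Type u) [Field K] (n : ℕ) where
  /-- the homogeneous basis of `Fᵢ` -/
  B : ℕ → Type u
  /-- the degrees of the basis elements -/
  deg : ∀ i, B i → ℤ
  /-- the differentials -/
  d : ∀ i, (B (i + 1) →₀ MvPolynomial (Fin n) K) →ₗ[MvPolynomial (Fin n) K]
    (B i →₀ MvPolynomial (Fin n) K)
  d_homogeneous : ∀ i b, d i (Finsupp.single b 1) ∈ homogeneousPart K n (deg i) (deg (i + 1) b)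
  d_comp_d : ∀ i, d i ∘ₗ d (i + 1) = 0

namespace GradedFreeComplex

variable {K : Type u} [Field K] {n : ℕ}

/-- `F` is a graded free resolution of the ideal `L`: there is an augmentation `F₀ → S`
of degree `0` with image `L` such that `⋯ → F₁ → F₀ → L → 0` is exact. -/
def IsResolution (F : GradedFreeComplex K n) (L : Ideal (MvPolynomial (Fin n) K)) : Prop :=
  ∃ ε : (F.B 0 →₀ MvPolynomial (Fin n) K) →ₗ[MvPolynomial (Fin n) K] MvPolynomial (Fin n) K,
    (∀ b, ∀ m ∈ (ε (Finsupp.single b 1)).support,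
      ((Finsupp.degree m : ℕ) : ℤ) = F.deg 0 b) ∧
    LinearMap.range ε = L ∧
    LinearMap.ker ε = LinearMap.range (F.d 0) ∧
    ∀ i, LinearMap.ker (F.d i) = LinearMap.range (F.d (i + 1))

/-- The module `K ⊗_S Fᵢ`, where `K = S/(x₁, …, xₙ)`. -/
abbrev residue (F : GradedFreeComplex K n) (i : ℕ) : Type u :=
  TensorProduct (MvPolynomial (Fin n) K)
    (MvPolynomial (Fin n) K ⧸ idealOfVars (Fin n) K) (F.B i →₀ MvPolynomial (Fin n) K)

/-- The differential `K ⊗_S Fᵢ₊₁ → K ⊗_S Fᵢ`. -/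
noncomputable def residueD (F : GradedFreeComplex K n) (i : ℕ) :
    F.residue (i + 1) →ₗ[MvPolynomial (Fin n) K] F.residue i :=
  (F.d i).lTensor (MvPolynomial (Fin n) K ⧸ idealOfVars (Fin n) K)

/-- The `i`-cycles of `K ⊗_S F`; everything is a cycle for `i = 0`. -/
noncomputable def cycles (F : GradedFreeComplex K n) :
    (i : ℕ) → Submodule (MvPolynomial (Fin n) K) (F.residue i)
  | 0 => ⊤
  | i + 1 => LinearMap.ker (F.residueD i)

/-- The degree `j` component of `K ⊗_S Fᵢ`. -/
noncomputable def residuePart (F : GradedFreeComplex K n) (i : ℕ) (j : ℤ) :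
    Submodule K (F.residue i) :=
  (homogeneousPart K n (F.deg i) j).map
    ((TensorProduct.mk (MvPolynomial (Fin n) K) (MvPolynomial (Fin n) K ⧸ idealOfVars (Fin n) K)
      (F.B i →₀ MvPolynomial (Fin n) K) 1).restrictScalars K)

/-- The cokernel of `K ⊗_S Fᵢ₊₁ → K ⊗_S Fᵢ`, of which the homology `Hᵢ(K ⊗_S F)`
(cycles modulo boundaries) is a submodule. -/
abbrev chainsModBoundaries (F : GradedFreeComplex K n) (i : ℕ) : Type u :=
  F.residue i ⧸ LinearMap.range (F.residueD i)

/-- The degree `j` component `Hᵢ(K ⊗_S F)_j` of the homology: the `K`-vector space of the classes,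
modulo boundaries, of the `i`-cycles of degree `j`. -/
noncomputable def homologyPart (F : GradedFreeComplex K n) (i : ℕ) (j : ℤ) :
    Submodule K (F.chainsModBoundaries i) :=
  ((F.cycles i).restrictScalars K ⊓ F.residuePart i j).map
    ((LinearMap.range (F.residueD i)).mkQ.restrictScalars K)

end GradedFreeComplex

/-- A submodule `Z` of a graded free `S`-module `⨁_{b ∈ B} S(-deg b)`. -/
structure Stage (K : Type u) [Field K] (n : ℕ) where
  /-- the homogeneous basis -/
  B : Type u
  /-- the degrees of the basis elements -/
  deg : B → ℤ
  /-- the submodule -/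
  Z : Submodule (MvPolynomial (Fin n) K) (B →₀ MvPolynomial (Fin n) K)

namespace Stage

variable {K : Type u} [Field K] {n : ℕ}

/-- The homogeneous elements of `Z`, together with their degrees. -/
abbrev Gen (T : Stage K n) : Type u :=
  {p : ℤ × (T.B →₀ MvPolynomial (Fin n) K) // p.2 ∈ T.Z ∧ p.2 ∈ homogeneousPart K n T.deg p.1}

/-- The map from the graded free module on all homogeneous elements of `Z` which sends each basis
element to the element of `Z` that it names. -/
noncomputable def cover (T : Stage K n) :
    (T.Gen →₀ MvPolynomial (Fin n) K) →ₗ[MvPolynomial (Fin n) K]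
      (T.B →₀ MvPolynomial (Fin n) K) :=
  Finsupp.linearCombination _ (fun p : T.Gen => p.1.2)

/-- The kernel of the cover of `Z`, in the graded free module on the homogeneous elements
of `Z`. -/
noncomputable abbrev next (T : Stage K n) : Stage K n where
  B := T.Gen
  deg := fun p => p.1.1
  Z := LinearMap.ker T.cover

/-- The ideal `L`, as a submodule of the free module with one basis element in degree `0`. -/
noncomputable abbrev ofIdeal (L : Ideal (MvPolynomial (Fin n) K)) : Stage K n where
  B := PUnit
  deg := fun _ => 0
  Z := Submodule.comap (Finsupp.lapply PUnit.unit) L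

/-- The iterated syzygy modules of `L`. -/
noncomputable abbrev syz (L : Ideal (MvPolynomial (Fin n) K)) (i : ℕ) : Stage K n :=
  Nat.rec (ofIdeal L) (fun _ T => T.next) i

lemma cover_mem (T : Stage K n) (f : T.Gen →₀ MvPolynomial (Fin n) K) : T.cover f ∈ T.Z := by
  rw [cover, Finsupp.linearCombination_apply]
  exact Submodule.sum_mem _ fun p _ => T.Z.smul_mem _ p.2.1

lemma cover_single (T : Stage K n) (p : T.Gen) : T.cover (Finsupp.single p 1) = p.1.2 := by
  simp [cover]

end Stage

variable {K : Type u} [Field K] {n : ℕ}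

/-- The standard graded free resolution of a graded ideal `L`: its `0`-th module is free on all
homogeneous elements of `L`, and its `(i+1)`-st module is free on all homogeneous elements of the
`i`-th syzygy module. -/
noncomputable abbrev standardResolution (L : Ideal (MvPolynomial (Fin n) K)) :
    GradedFreeComplex K n where
  B := fun i => (Stage.syz L i).Gen
  deg := fun i p => p.1.1
  d := fun i => (Stage.syz L (i + 1)).cover
  d_homogeneous := fun i b => by
    rw [(Stage.syz L (i + 1)).cover_single b]
    exact b.2.2
  d_comp_d := fun i => LinearMap.ext fun f => (Stage.syz L (i + 2)).cover_mem f

section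

attribute [local instance] MvPolynomial.gradedAlgebra

lemma homogeneousPart_iSup {B : Type u} (deg : B → ℤ) :
    ⨆ j, homogeneousPart K n deg j = ⊤ := by
  rw [eq_top_iff]
  intro f _
  induction f using Finsupp.induction_linear with
  | zero => exact zero_mem _
  | add f g hf hg => exact add_mem (hf trivial) (hg trivial)
  | single b p =>
    induction p using MvPolynomial.induction_on' with
    | monomial m c =>
      refine Submodule.mem_iSup_of_mem (((Finsupp.degree m : ℕ) : ℤ) + deg b) ?_
      intro b' m' hm'
      classical
      rw [Finsupp.single_apply] at hm'
      split_ifs at hm' with h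
      · subst h
        have := MvPolynomial.support_monomial_subset hm'
        rw [Finset.mem_singleton] at this
        rw [this]
      · simp at hm'
    | add p q hp hq =>
      rw [Finsupp.single_add]
      exact add_mem (hp trivial) (hq trivial)

lemma homogeneousPart_sum_eq_zero {B : Type u} (deg : B → ℤ) (s : Finset ℤ)
    (g : ℤ → (B →₀ MvPolynomial (Fin n) K)) (hg : ∀ j, g j ∈ homogeneousPart K n deg j)
    (h : ∑ j ∈ s, g j = 0) : ∀ j ∈ s, g j = 0 := by
  intro j hj
  ext b m
  by_contra hne
  have hdeg := hg j b m (MvPolynomial.mem_support_iff.2 hne)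
  apply hne
  have h1 : MvPolynomial.coeff m ((∑ j ∈ s, g j) b) = 0 := by rw [h]; simp
  rw [Finsupp.finsetSum_apply, MvPolynomial.coeff_sum, Finset.sum_eq_single j] at h1
  · simpa using h1
  · intro k _ hk
    by_contra hne'
    exact hk ((hg k b m (MvPolynomial.mem_support_iff.2 hne')).symm.trans hdeg)
  · exact fun h => absurd hj h

lemma homogeneousPart_smul {B : Type u} (deg : B → ℤ) {p : MvPolynomial (Fin n) K} {i j : ℤ}
    (hp : ∀ m ∈ p.support, ((Finsupp.degree m : ℕ) : ℤ) = i)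
    {f : B →₀ MvPolynomial (Fin n) K} (hf : f ∈ homogeneousPart K n deg j) :
    p • f ∈ homogeneousPart K n deg (i + j) := by
  classical
  intro b m hm
  rw [Finsupp.smul_apply, smul_eq_mul] at hm
  obtain ⟨a, ha, c, hc, rfl⟩ := Finset.mem_add.1 (MvPolynomial.support_mul _ _ hm)
  have h1 := hp a ha
  have h2 := hf b c hc
  rw [map_add]
  push_cast
  lia

namespace Stage

lemma cover_homogeneous (T : Stage K n) {j : ℤ} {f : T.Gen →₀ MvPolynomial (Fin n) K}
    (hf : f ∈ homogeneousPart K n T.next.deg j) :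
    T.cover f ∈ homogeneousPart K n T.deg j := by
  rw [cover, Finsupp.linearCombination_apply]
  refine Submodule.sum_mem _ fun p _ => ?_
  have := homogeneousPart_smul T.deg (p := f p) (i := j - p.1.1)
    (fun m hm => by have := hf p m hm; simp only at this; lia) p.2.2
  simpa using this

/-- `Z` is a graded submodule: it contains the homogeneous components of its elements. -/
def IsGraded (T : Stage K n) : Prop :=
  ∀ (s : Finset ℤ) (g : ℤ → (T.B →₀ MvPolynomial (Fin n) K)),
    (∀ j, g j ∈ homogeneousPart K n T.deg j) → ∑ j ∈ s, g j ∈ T.Z → ∀ j ∈ s, g j ∈ T.Z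

lemma IsGraded.range_cover {T : Stage K n} (hT : T.IsGraded) :
    LinearMap.range T.cover = T.Z := by
  apply le_antisymm
  · rintro _ ⟨f, rfl⟩
    exact T.cover_mem f
  · intro f hf
    have hmem : f ∈ ⨆ j, homogeneousPart K n T.deg j := by
      rw [homogeneousPart_iSup]; trivial
    obtain ⟨g, hg, rfl⟩ := (Submodule.mem_iSup_iff_exists_finsupp _ _).1 hmem
    have := hT g.support g hg hf
    refine Submodule.sum_mem _ fun j hj => ?_
    exact ⟨Finsupp.single ⟨(j, g j), this j hj, hg j⟩ 1, T.cover_single _⟩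

lemma isGraded_next (T : Stage K n) : T.next.IsGraded := by
  intro s g hg h j hj
  have h' : ∑ j ∈ s, T.cover (g j) = 0 := by
    rw [← map_sum]; exact h
  exact homogeneousPart_sum_eq_zero T.deg s (fun j => T.cover (g j))
    (fun j => T.cover_homogeneous (hg j)) h' j hj

lemma isGraded_ofIdeal {L : Ideal (MvPolynomial (Fin n) K)}
    (hL : L.IsHomogeneous (homogeneousSubmodule (Fin n) K)) : (ofIdeal L).IsGraded := by
  intro s g hg h j hj
  change (∑ j ∈ s, g j) PUnit.unit ∈ L at h
  change g j PUnit.unit ∈ L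
  by_cases hj0 : 0 ≤ j
  · lift j to ℕ using hj0
    have h1 := hL j h
    rw [Finsupp.finsetSum_apply, ← GradedRing.proj_apply, map_sum,
      Finset.sum_eq_single (j : ℤ)] at h1
    · rw [GradedRing.proj_apply, DirectSum.decompose_of_mem_same] at h1
      · exact h1
      · intro m hm
        have := hg j PUnit.unit m (MvPolynomial.mem_support_iff.2 hm)
        simp only [add_zero, Nat.cast_inj] at this
        rw [← this, Finsupp.degree_eq_weight_one]
        rfl
    · intro k _ hk
      by_cases hk0 : 0 ≤ k
      · lift k to ℕ using hk0
        refine DirectSum.decompose_of_mem_ne (i := k) (homogeneousSubmodule (Fin n) K) ?_ ?_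
        · intro m hm
          have := hg k PUnit.unit m (MvPolynomial.mem_support_iff.2 hm)
          simp only [add_zero, Nat.cast_inj] at this
          rw [← this, Finsupp.degree_eq_weight_one]
          rfl
        · exact fun h => hk (by rw [h])
      · have : g k PUnit.unit = 0 := by
          ext m
          by_contra hne
          have := hg k PUnit.unit m (MvPolynomial.mem_support_iff.2 hne)
          simp only [add_zero] at this
          lia
        rw [this, map_zero]
    · exact fun h => absurd hj h
  · have : g j PUnit.unit = 0 := by
      ext m
      by_contra hne
      have := hg j PUnit.unit m (MvPolynomial.mem_support_iff.2 hne)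
      simp only [add_zero] at this
      lia
    rw [this]
    exact L.zero_mem

end Stage

/-- For a graded ideal, the standard resolution is a graded free resolution. -/
lemma standardResolution_isResolution {L : Ideal (MvPolynomial (Fin n) K)}
    (hL : L.IsHomogeneous (homogeneousSubmodule (Fin n) K)) :
    (standardResolution L).IsResolution L := by
  have h0 := (Stage.isGraded_ofIdeal hL).range_cover
  refine ⟨Finsupp.lapply PUnit.unit ∘ₗ (Stage.ofIdeal L).cover, ?_, ?_, ?_, ?_⟩
  · intro p m hm
    have h : (Stage.ofIdeal L).cover (Finsupp.single p 1) = p.1.2 := Stage.cover_single _ p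
    change m ∈ ((Stage.ofIdeal L).cover (Finsupp.single p 1) PUnit.unit).support at hm
    rw [h] at hm
    have := p.2.2 PUnit.unit m hm
    simpa using this
  · rw [LinearMap.range_comp, h0]
    refine Submodule.map_comap_eq_of_surjective (fun p => ?_) L
    exact ⟨Finsupp.single PUnit.unit p, by simp⟩
  · refine Eq.trans ?_ (Stage.isGraded_next (Stage.ofIdeal L)).range_cover.symm
    ext f
    change (Stage.ofIdeal L).cover f PUnit.unit = 0 ↔ (Stage.ofIdeal L).cover f = 0
    constructor
    · intro h
      ext1
      exact h
    · intro h
      rw [h]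
      rfl
  · intro i
    exact (Stage.isGraded_next (Stage.syz L (i + 1))).range_cover.symm

/-- A monomial ideal is graded. -/
lemma IsMonomialIdeal.isHomogeneous {I : Ideal (MvPolynomial (Fin n) K)}
    (hI : IsMonomialIdeal I) : I.IsHomogeneous (homogeneousSubmodule (Fin n) K) := by
  obtain ⟨A, rfl⟩ := hI
  apply Ideal.homogeneous_span
  rintro _ ⟨a, _, rfl⟩
  exact ⟨Finsupp.degree a, isHomogeneous_monomial 1 rfl⟩

end

/-- The graded component `Tor_i^S(K, L)_j` for a graded ideal `L` of `S = K[x₁, …, xₙ]`. -/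
noncomputable def torPart (L : Ideal (MvPolynomial (Fin n) K)) (i : ℕ) (j : ℤ) :
    Submodule K ((standardResolution L).chainsModBoundaries i) :=
  (standardResolution L).homologyPart i j

/-- `M_i(L) = max {j | Tor_i^S(K, L)_j ≠ 0}`, in the extended reals; `-∞` if there is
no such `j`. -/
noncomputable def maxShift (L : Ideal (MvPolynomial (Fin n) K)) (i : ℕ) : EReal :=
  ⨆ j : {j : ℤ // torPart L i j ≠ ⊥}, (((j : ℤ) : ℝ) : EReal)

/-- The Castelnuovo–Mumford regularity `reg(L) = max {M_i(L) - i | i ≥ 0}` of a graded ideal `L`;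
it is `-∞` for `L = 0`. -/
noncomputable def reg (L : Ideal (MvPolynomial (Fin n) K)) : EReal :=
  ⨆ i : ℕ, (maxShift L i - ((i : ℝ) : EReal))

/-- The projective dimension of an ideal `L` as a module over `S = K[x₁, …, xₙ]`;
it is `-∞` for `L = 0`. -/
noncomputable def projdim (L : Ideal (MvPolynomial (Fin n) K)) : WithBot ℕ∞ :=
  projectiveDimension (ModuleCat.of (MvPolynomial (Fin n) K) L)

end GradedTor

/-! The proof builds a free resolution of `I ⊓ J` out of minimal multigraded resolutions of `I` and
`J`. A multigraded free complex is encoded by a scalar matrix and the multidegrees of its basis; its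
component in multidegree `a`, the strand, is the complex of `K`-vector spaces spanned by the basis
elements whose multidegree divides `a`. The complex resolves a monomial ideal exactly when each
strand resolves `K` or `0`, according to whether `x^a` lies in the ideal.

Take all pairs of basis elements, with the tensor product differential and with the least common
multiple as multidegree. Since `lcm(u, v)` divides `x^a` iff both `u` and `v` do, the strand of this
product at `a` is the tensor product over `K` of the two strands. Contractions of the factors
combine to a contraction of the product, so it resolves `I ⊓ J`
(`MultigradedComplex.Resolves.prod`). Homological degrees add, and the degree of an lcm is at most
the sum of the degrees.

Minimality makes these bounds the right ones. A minimal resolution is no longer than the projective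
dimension (`IsMinimal.isEmpty`), and each of its basis degrees is a degree of `Tor`
(`IsMinimal.homologyPart_ne_bot`). The product need not be minimal, but any resolution bounds the
projective dimension (`hasProjectiveDimensionLT_of_isEmpty`) and the degrees of `Tor`
(`IsResolution.homologyPart_eq_bot`) from above. As `Tor` is defined by the standard resolution,
resolutions are compared through homotopy equivalences of degree `0`. -/

namespace GradedTor

open MvPolynomial CategoryTheory

/-! ### Lifting maps of graded free modules -/

section Lifting

variable {K : Type u} [Field K] {n : ℕ}

/-- A map of graded free modules of degree `0`. -/
def IsGradedMap {B C : Type u} (deg : B → ℤ) (deg' : C → ℤ)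
    (φ : (B →₀ MvPolynomial (Fin n) K) →ₗ[MvPolynomial (Fin n) K] (C →₀ MvPolynomial (Fin n) K)) :
    Prop :=
  ∀ b, φ (Finsupp.single b 1) ∈ homogeneousPart K n deg' (deg b)

variable {B C D : Type u} {deg : B → ℤ} {deg' : C → ℤ} {deg'' : D → ℤ}

lemma IsGradedMap.map_mem
    {φ : (B →₀ MvPolynomial (Fin n) K) →ₗ[MvPolynomial (Fin n) K] (C →₀ MvPolynomial (Fin n) K)}
    (hφ : IsGradedMap deg deg' φ) {j : ℤ} {f : B →₀ MvPolynomial (Fin n) K}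
    (hf : f ∈ homogeneousPart K n deg j) : φ f ∈ homogeneousPart K n deg' j := by
  have h : φ f = f.sum fun b p => p • φ (Finsupp.single b 1) := by
    conv_lhs => rw [← Finsupp.sum_single f]
    rw [Finsupp.sum, map_sum]
    refine Finset.sum_congr rfl fun b _ => ?_
    change φ (Finsupp.single b (f b)) = f b • φ (Finsupp.single b 1)
    rw [← map_smul, Finsupp.smul_single, smul_eq_mul, mul_one]
  rw [h]
  refine Submodule.sum_mem _ fun b _ => ?_
  have := homogeneousPart_smul deg' (p := f b) (i := j - deg b)
    (fun m hm => by have := hf b m hm; lia) (hφ b)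
  simpa using this

lemma IsGradedMap.comp
    {φ : (B →₀ MvPolynomial (Fin n) K) →ₗ[MvPolynomial (Fin n) K] (C →₀ MvPolynomial (Fin n) K)}
    {ψ : (C →₀ MvPolynomial (Fin n) K) →ₗ[MvPolynomial (Fin n) K] (D →₀ MvPolynomial (Fin n) K)}
    (hψ : IsGradedMap deg' deg'' ψ) (hφ : IsGradedMap deg deg' φ) :
    IsGradedMap deg deg'' (ψ ∘ₗ φ) :=
  fun b => hψ.map_mem (hφ b)

lemma single_one_mem_homogeneousPart (b : B) :
    (Finsupp.single b 1 : B →₀ MvPolynomial (Fin n) K) ∈ homogeneousPart K n deg (deg b) := by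
  classical
  intro x m hm
  rw [Finsupp.single_apply] at hm
  split_ifs at hm with hx
  · subst hx
    rw [MvPolynomial.mem_support_iff, MvPolynomial.coeff_one] at hm
    have : m = 0 := by
      by_contra hne
      exact hm (if_neg (Ne.symm hne))
    simp [this]
  · simp at hm

/-- Split any preimage into homogeneous components. Components in the target are unique, so the
component of degree `j` alone maps to `y`. -/
lemma exists_homogeneous_preimage
    {p : (C →₀ MvPolynomial (Fin n) K) →ₗ[MvPolynomial (Fin n) K] (D →₀ MvPolynomial (Fin n) K)}
    (hp : IsGradedMap deg' deg'' p) {j : ℤ} {y : D →₀ MvPolynomial (Fin n) K}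
    (hy : y ∈ homogeneousPart K n deg'' j) (hyp : y ∈ LinearMap.range p) :
    ∃ x ∈ homogeneousPart K n deg' j, p x = y := by
  classical
  obtain ⟨x, rfl⟩ := hyp
  have hmem : x ∈ ⨆ j, homogeneousPart K n deg' j := by
    rw [homogeneousPart_iSup]; trivial
  obtain ⟨g, hg, rfl⟩ := (Submodule.mem_iSup_iff_exists_finsupp _ _).1 hmem
  refine ⟨g j, hg j, ?_⟩
  set y := p (∑ i ∈ g.support, g i) with hydef
  -- The difference of the two decompositions of `y` is a vanishing sum of homogeneous terms.
  -- Inserting `j` covers the case where the preimage has no component of degree `j`.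
  have key := homogeneousPart_sum_eq_zero deg'' (insert j g.support)
    (fun i => p (g i) - if i = j then y else 0) (fun i => by
      refine Submodule.sub_mem _ (hp.map_mem (hg i)) ?_
      split_ifs with h
      · rw [h]; exact hy
      · exact zero_mem _) (by
      rw [Finset.sum_sub_distrib, Finset.sum_ite_eq' , if_pos (Finset.mem_insert_self _ _),
        ← map_sum, hydef, sub_eq_zero]
      congr 1
      by_cases hj : j ∈ g.support
      · rw [Finset.insert_eq_of_mem hj]
      · rw [Finset.sum_insert hj, Finsupp.notMem_support_iff.1 hj, zero_add])
    j (Finset.mem_insert_self _ _)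
  rw [if_pos rfl, sub_eq_zero] at key
  exact key

/-- Graded free modules are projective with respect to maps of degree `0`. -/
lemma exists_graded_lift
    {p : (C →₀ MvPolynomial (Fin n) K) →ₗ[MvPolynomial (Fin n) K] (D →₀ MvPolynomial (Fin n) K)}
    (hp : IsGradedMap deg' deg'' p)
    {q : (B →₀ MvPolynomial (Fin n) K) →ₗ[MvPolynomial (Fin n) K] (D →₀ MvPolynomial (Fin n) K)}
    (hq : IsGradedMap deg deg'' q) (h : LinearMap.range q ≤ LinearMap.range p) :
    ∃ φ : (B →₀ MvPolynomial (Fin n) K) →ₗ[MvPolynomial (Fin n) K] (C →₀ MvPolynomial (Fin n) K),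
      IsGradedMap deg deg' φ ∧ p ∘ₗ φ = q := by
  choose x hx hpx using fun b =>
    exists_homogeneous_preimage hp (hq b) (h ⟨Finsupp.single b 1, rfl⟩)
  refine ⟨Finsupp.linearCombination _ x, fun b => ?_, ?_⟩
  · simpa using hx b
  · ext1 b
    ext1
    simp [hpx]

/-- Dependent choice along `ℕ`. -/
lemma exists_seq_of_step {α : ℕ → Type*} (Q : ∀ i, α i → Prop) (R : ∀ i, α i → α (i + 1) → Prop)
    (a₀ : α 0) (h₀ : Q 0 a₀) (step : ∀ i a, Q i a → ∃ a', Q (i + 1) a' ∧ R i a a') :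
    ∃ s : ∀ i, α i, s 0 = a₀ ∧ ∀ i, Q i (s i) ∧ R i (s i) (s (i + 1)) := by
  choose f hf using step
  let t : ∀ i, {a : α i // Q i a} := fun i =>
    Nat.rec ⟨a₀, h₀⟩ (fun i a => ⟨f i a.1 a.2, (hf i a.1 a.2).1⟩) i
  exact ⟨fun i => (t i).1, rfl, fun i => ⟨(t i).2, (hf i (t i).1 (t i).2).2⟩⟩

end Lifting

/-! ### Comparison of graded free resolutions -/

namespace GradedFreeComplex

variable {K : Type u} [Field K] {n : ℕ} {F G : GradedFreeComplex K n}
  {L : Ideal (MvPolynomial (Fin n) K)}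

/-- An augmentation of `F` onto `L`, with values in the free module of rank one. -/
lemma IsResolution.exists_augmentation (hF : F.IsResolution L) :
    ∃ ε : (F.B 0 →₀ MvPolynomial (Fin n) K) →ₗ[MvPolynomial (Fin n) K]
        (PUnit.{u + 1} →₀ MvPolynomial (Fin n) K),
      IsGradedMap (F.deg 0) (fun _ => 0) ε ∧
      (∀ f, f ∈ LinearMap.range ε ↔ f PUnit.unit ∈ L) ∧
      LinearMap.ker ε = LinearMap.range (F.d 0) := by
  obtain ⟨ε, h1, h2, h3, -⟩ := hF
  refine ⟨Finsupp.lsingle PUnit.unit ∘ₗ ε, fun b x m hm => ?_, ?_, ?_⟩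
  · simpa using h1 b m (by simpa using hm)
  · intro f
    rw [← h2]
    simp only [LinearMap.mem_range, LinearMap.comp_apply, Finsupp.lsingle_apply]
    refine exists_congr fun x => ⟨fun h => by rw [← h]; simp, fun h => ?_⟩
    ext1
    simp [h]
  · rw [← h3]
    ext f
    simp

lemma IsResolution.exact (hF : F.IsResolution L) (i : ℕ) :
    LinearMap.ker (F.d i) = LinearMap.range (F.d (i + 1)) := by
  obtain ⟨-, -, -, -, h⟩ := hF
  exact h i

/-- A resolution is exact, so a graded map into the kernel of a differential lifts. -/
lemma IsResolution.exists_lift (hF : F.IsResolution L) {i : ℕ} {B : Type u} {deg : B → ℤ}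
    {q : (B →₀ MvPolynomial (Fin n) K) →ₗ[MvPolynomial (Fin n) K]
      (F.B (i + 1) →₀ MvPolynomial (Fin n) K)}
    (hq : IsGradedMap deg (F.deg (i + 1)) q) (h : F.d i ∘ₗ q = 0) :
    ∃ φ, IsGradedMap deg (F.deg (i + 2)) φ ∧ F.d (i + 1) ∘ₗ φ = q := by
  refine exists_graded_lift (F.d_homogeneous (i + 1)) hq ?_
  rw [← hF.exact i]
  rintro _ ⟨x, rfl⟩
  exact LinearMap.congr_fun h x

/-- Comparison of resolutions: two augmented graded free complexes over the same ideal are connected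
by a chain map of degree `0`. -/
lemma exists_chainMap (hG : G.IsResolution L)
    {εF : (F.B 0 →₀ MvPolynomial (Fin n) K) →ₗ[MvPolynomial (Fin n) K]
        (PUnit.{u + 1} →₀ MvPolynomial (Fin n) K)}
    {εG : (G.B 0 →₀ MvPolynomial (Fin n) K) →ₗ[MvPolynomial (Fin n) K]
        (PUnit.{u + 1} →₀ MvPolynomial (Fin n) K)}
    (gF : IsGradedMap (F.deg 0) (fun _ => 0) εF) (gG : IsGradedMap (G.deg 0) (fun _ => 0) εG)
    (hr : LinearMap.range εF ≤ LinearMap.range εG) (hkF : εF ∘ₗ F.d 0 = 0)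
    (hkG : LinearMap.ker εG = LinearMap.range (G.d 0)) :
    ∃ φ : ∀ i, (F.B i →₀ MvPolynomial (Fin n) K) →ₗ[MvPolynomial (Fin n) K]
        (G.B i →₀ MvPolynomial (Fin n) K),
      (∀ i, IsGradedMap (F.deg i) (G.deg i) (φ i)) ∧ εG ∘ₗ φ 0 = εF ∧
      ∀ i, G.d i ∘ₗ φ (i + 1) = φ i ∘ₗ F.d i := by
  obtain ⟨φ₀, g₀, h₀⟩ := exists_graded_lift gG gF hr
  obtain ⟨φ, hφ0, hφ⟩ := exists_seq_of_step
    (α := fun i => (F.B i →₀ MvPolynomial (Fin n) K) →ₗ[MvPolynomial (Fin n) K]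
        (G.B i →₀ MvPolynomial (Fin n) K))
    -- The invariant carries the range condition because it is precisely what makes the next lift
    -- possible.
    (fun i φ => IsGradedMap (F.deg i) (G.deg i) φ ∧
      LinearMap.range (φ ∘ₗ F.d i) ≤ LinearMap.range (G.d i))
    (fun i φ φ' => G.d i ∘ₗ φ' = φ ∘ₗ F.d i) φ₀ ⟨g₀, by
      rw [← hkG]
      rintro _ ⟨x, rfl⟩
      rw [LinearMap.mem_ker, ← LinearMap.comp_apply, ← LinearMap.comp_assoc, h₀, hkF,
        LinearMap.zero_apply]⟩
    (by
      rintro i φ ⟨g, h⟩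
      obtain ⟨φ', g', h'⟩ := exists_graded_lift (G.d_homogeneous i) (g.comp (F.d_homogeneous i)) h
      refine ⟨φ', ⟨g', ?_⟩, h'⟩
      rw [← hG.exact i]
      rintro _ ⟨x, rfl⟩
      rw [LinearMap.mem_ker, ← LinearMap.comp_apply, ← LinearMap.comp_assoc, h',
        LinearMap.comp_assoc, F.d_comp_d, LinearMap.comp_zero, LinearMap.zero_apply])
  exact ⟨φ, fun i => (hφ i).1.1, hφ0 ▸ h₀, fun i => (hφ i).2⟩

/-- A chain map of degree `0` from a resolution to itself which is zero on the augmentation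
is null-homotopic. -/
lemma exists_nullHomotopy (hF : F.IsResolution L)
    {εF : (F.B 0 →₀ MvPolynomial (Fin n) K) →ₗ[MvPolynomial (Fin n) K]
        (PUnit.{u + 1} →₀ MvPolynomial (Fin n) K)}
    (hkF : LinearMap.ker εF = LinearMap.range (F.d 0))
    (δ : ∀ i, (F.B i →₀ MvPolynomial (Fin n) K) →ₗ[MvPolynomial (Fin n) K]
        (F.B i →₀ MvPolynomial (Fin n) K))
    (gδ : ∀ i, IsGradedMap (F.deg i) (F.deg i) (δ i)) (hδ0 : εF ∘ₗ δ 0 = 0)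
    (hδ : ∀ i, F.d i ∘ₗ δ (i + 1) = δ i ∘ₗ F.d i) :
    ∃ h : ∀ i, (F.B i →₀ MvPolynomial (Fin n) K) →ₗ[MvPolynomial (Fin n) K]
        (F.B (i + 1) →₀ MvPolynomial (Fin n) K),
      F.d 0 ∘ₗ h 0 = δ 0 ∧ ∀ i, F.d (i + 1) ∘ₗ h (i + 1) = δ (i + 1) - h i ∘ₗ F.d i := by
  obtain ⟨h₀, g₀, e₀⟩ := exists_graded_lift (F.d_homogeneous 0) (gδ 0) (by
    rw [← hkF]
    rintro _ ⟨x, rfl⟩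
    exact LinearMap.congr_fun hδ0 x)
  obtain ⟨h, hh0, hh⟩ := exists_seq_of_step
    (α := fun i => (F.B i →₀ MvPolynomial (Fin n) K) →ₗ[MvPolynomial (Fin n) K]
        (F.B (i + 1) →₀ MvPolynomial (Fin n) K))
    -- The second half of the invariant says that the map to be lifted next takes values in cycles.
    (fun i h => IsGradedMap (F.deg i) (F.deg (i + 1)) h ∧
      F.d i ∘ₗ (δ (i + 1) - h ∘ₗ F.d i) = 0)
    (fun i h h' => F.d (i + 1) ∘ₗ h' = δ (i + 1) - h ∘ₗ F.d i) h₀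
    ⟨g₀, by
      rw [LinearMap.comp_sub, ← LinearMap.comp_assoc, e₀, hδ]
      ext1 b
      ext1
      simp⟩
    (by
      rintro i h ⟨g, e⟩
      obtain ⟨h', g', e'⟩ := hF.exists_lift (q := δ (i + 1) - h ∘ₗ F.d i)
        (fun b => Submodule.sub_mem _ (gδ _ b) (g.comp (F.d_homogeneous i) b)) e
      refine ⟨h', ⟨g', ?_⟩, e'⟩
      rw [LinearMap.comp_sub, ← LinearMap.comp_assoc, e', hδ, LinearMap.sub_comp,
        LinearMap.comp_assoc _ _ h, F.d_comp_d, LinearMap.comp_zero]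
      ext1 b
      ext1
      simp)
  exact ⟨h, hh0 ▸ e₀, fun i => (hh i).2⟩

/-- Two graded free resolutions of the same ideal are homotopy equivalent in degree `0`. -/
lemma IsResolution.exists_homotopy (hF : F.IsResolution L) (hG : G.IsResolution L) :
    ∃ (φ : ∀ i, (F.B i →₀ MvPolynomial (Fin n) K) →ₗ[MvPolynomial (Fin n) K]
        (G.B i →₀ MvPolynomial (Fin n) K))
      (ψ : ∀ i, (G.B i →₀ MvPolynomial (Fin n) K) →ₗ[MvPolynomial (Fin n) K]
        (F.B i →₀ MvPolynomial (Fin n) K))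
      (h : ∀ i, (F.B i →₀ MvPolynomial (Fin n) K) →ₗ[MvPolynomial (Fin n) K]
        (F.B (i + 1) →₀ MvPolynomial (Fin n) K)),
      (∀ i, IsGradedMap (F.deg i) (G.deg i) (φ i)) ∧
      (∀ i, G.d i ∘ₗ φ (i + 1) = φ i ∘ₗ F.d i) ∧
      (∀ i, F.d i ∘ₗ ψ (i + 1) = ψ i ∘ₗ G.d i) ∧
      F.d 0 ∘ₗ h 0 = ψ 0 ∘ₗ φ 0 - LinearMap.id ∧
      ∀ i, F.d (i + 1) ∘ₗ h (i + 1) =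
        ψ (i + 1) ∘ₗ φ (i + 1) - LinearMap.id - h i ∘ₗ F.d i := by
  obtain ⟨εF, gF, rF, kF⟩ := hF.exists_augmentation
  obtain ⟨εG, gG, rG, kG⟩ := hG.exists_augmentation
  have zF : εF ∘ₗ F.d 0 = 0 := LinearMap.range_le_ker_iff.1 kF.ge
  have zG : εG ∘ₗ G.d 0 = 0 := LinearMap.range_le_ker_iff.1 kG.ge
  obtain ⟨φ, gφ, φ0, hφ⟩ := exists_chainMap hG gF gG (fun f hf => (rG f).2 ((rF f).1 hf)) zF kG
  obtain ⟨ψ, gψ, ψ0, hψ⟩ := exists_chainMap hF gG gF (fun f hf => (rF f).2 ((rG f).1 hf)) zG kF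
  obtain ⟨h, h0, h1⟩ := exists_nullHomotopy hF kF (fun i => ψ i ∘ₗ φ i - LinearMap.id)
    (fun i b => Submodule.sub_mem _ ((gψ i).comp (gφ i) b) (single_one_mem_homogeneousPart b))
    (LinearMap.ext fun x => by
      have h1 := LinearMap.congr_fun ψ0 (φ 0 x)
      have h2 := LinearMap.congr_fun φ0 x
      simp only [LinearMap.comp_apply] at h1 h2
      simp [h1, h2])
    (fun i => LinearMap.ext fun x => by
      have h1 := LinearMap.congr_fun (hψ i) (φ (i + 1) x)
      have h2 := LinearMap.congr_fun (hφ i) x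
      simp only [LinearMap.comp_apply] at h1 h2
      simp [h1, h2])
  exact ⟨φ, ψ, h, gφ, hφ, hψ, h0, h1⟩

end GradedFreeComplex

/-! ### Reduction modulo the ideal of the variables -/

lemma mem_idealOfVars_iff {K : Type u} [Field K] {n : ℕ} (p : MvPolynomial (Fin n) K) :
    p ∈ idealOfVars (Fin n) K ↔ MvPolynomial.coeff 0 p = 0 := by
  have h := mem_pow_idealOfVars_iff' (σ := Fin n) (R := K) 1 p
  rw [pow_one] at h
  rw [h]
  constructor
  · exact fun h => h 0 (by simp)
  · intro h x hx
    have : x = 0 := (Finsupp.degree_eq_zero_iff x).1 (by simpa using hx)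
    rw [this, h]

lemma smul_one_residue {K : Type u} [Field K] {n : ℕ} (p : MvPolynomial (Fin n) K) :
    p • (1 : MvPolynomial (Fin n) K ⧸ idealOfVars (Fin n) K) =
      Ideal.Quotient.mk (idealOfVars (Fin n) K) p := by
  change Ideal.Quotient.mk (idealOfVars (Fin n) K) (p * 1) = _
  rw [mul_one]

section Residue

variable {K : Type u} [Field K] {n : ℕ} {B C : Type u}

/-- The submodule `𝔪F` of a free module `F`. -/
def maxSubmodule (K : Type u) [Field K] (n : ℕ) (B : Type u) :
    Submodule (MvPolynomial (Fin n) K) (B →₀ MvPolynomial (Fin n) K) where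
  carrier := {f | ∀ b, f b ∈ idealOfVars (Fin n) K}
  zero_mem' := fun _ => zero_mem _
  add_mem' := fun hf hg b => add_mem (hf b) (hg b)
  smul_mem' := fun c _ hf b => Ideal.mul_mem_left _ c (hf b)

lemma map_mem_maxSubmodule
    (φ : (B →₀ MvPolynomial (Fin n) K) →ₗ[MvPolynomial (Fin n) K] (C →₀ MvPolynomial (Fin n) K))
    {f : B →₀ MvPolynomial (Fin n) K} (hf : f ∈ maxSubmodule K n B) :
    φ f ∈ maxSubmodule K n C := by
  have h : φ f = f.sum fun b p => p • φ (Finsupp.single b 1) := by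
    conv_lhs => rw [← Finsupp.sum_single f]
    rw [Finsupp.sum, map_sum]
    refine Finset.sum_congr rfl fun b _ => ?_
    change φ (Finsupp.single b (f b)) = f b • φ (Finsupp.single b 1)
    rw [← map_smul, Finsupp.smul_single, smul_eq_mul, mul_one]
  rw [h]
  exact Submodule.sum_mem _ fun b _ c => Ideal.mul_mem_right _ _ (hf b)

lemma range_le_maxSubmodule
    {φ : (B →₀ MvPolynomial (Fin n) K) →ₗ[MvPolynomial (Fin n) K] (C →₀ MvPolynomial (Fin n) K)}
    (h : ∀ b, φ (Finsupp.single b 1) ∈ maxSubmodule K n C) (f : B →₀ MvPolynomial (Fin n) K) :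
    φ f ∈ maxSubmodule K n C := by
  induction f using Finsupp.induction_linear with
  | zero => rw [map_zero]; exact zero_mem _
  | add f g hf hg => rw [map_add]; exact add_mem hf hg
  | single b p =>
    have : (Finsupp.single b p : B →₀ MvPolynomial (Fin n) K) = p • Finsupp.single b 1 := by
      rw [Finsupp.smul_single, smul_eq_mul, mul_one]
    rw [this, map_smul]
    exact Submodule.smul_mem _ _ (h b)

lemma single_one_notMem_maxSubmodule (b : B) :
    (Finsupp.single b 1 : B →₀ MvPolynomial (Fin n) K) ∉ maxSubmodule K n B := by
  intro h
  have := h b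
  rw [Finsupp.single_eq_same, mem_idealOfVars_iff] at this
  simp at this

/-- This identifies `K ⊗ F` with `F/𝔪F`, so that cycles and boundaries can be handled through
representatives in `F`. One direction applies the coordinate functionals `K ⊗ F → K`; the other
moves coefficients across the tensor sign. -/
lemma mk_one_eq_zero_iff (f : B →₀ MvPolynomial (Fin n) K) :
    (1 : MvPolynomial (Fin n) K ⧸ idealOfVars (Fin n) K) ⊗ₜ[MvPolynomial (Fin n) K] f = 0 ↔
      f ∈ maxSubmodule K n B := by
  classical
  constructor
  · intro h b
    have h2 := congrArg (TensorProduct.lift ((LinearMap.lsmul (MvPolynomial (Fin n) K)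
      (MvPolynomial (Fin n) K ⧸ idealOfVars (Fin n) K)).flip.compl₂ (Finsupp.lapply b))) h
    simp only [TensorProduct.lift.tmul, map_zero] at h2
    have h3 : f b • (1 : MvPolynomial (Fin n) K ⧸ idealOfVars (Fin n) K) = 0 := h2
    rwa [smul_one_residue, Ideal.Quotient.eq_zero_iff_mem] at h3
  · intro h
    conv_lhs => rw [← Finsupp.sum_single f]
    rw [Finsupp.sum, TensorProduct.tmul_sum]
    refine Finset.sum_eq_zero fun b _ => ?_
    have : (Finsupp.single b (f b) : B →₀ MvPolynomial (Fin n) K)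
        = f b • Finsupp.single b 1 := by
      rw [Finsupp.smul_single, smul_eq_mul, mul_one]
    rw [this, ← TensorProduct.smul_tmul, smul_one_residue,
      Ideal.Quotient.eq_zero_iff_mem.2 (h b), TensorProduct.zero_tmul]

lemma lTensor_eq_zero
    {φ : (B →₀ MvPolynomial (Fin n) K) →ₗ[MvPolynomial (Fin n) K] (C →₀ MvPolynomial (Fin n) K)}
    (h : ∀ b, φ (Finsupp.single b 1) ∈ maxSubmodule K n C) :
    φ.lTensor (MvPolynomial (Fin n) K ⧸ idealOfVars (Fin n) K) = 0 := by
  refine TensorProduct.ext' fun q f => ?_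
  obtain ⟨p, rfl⟩ := Ideal.Quotient.mk_surjective q
  rw [LinearMap.lTensor_tmul, ← smul_one_residue, ← TensorProduct.smul_tmul',
    (mk_one_eq_zero_iff _).2 (range_le_maxSubmodule h f), smul_zero, LinearMap.zero_apply]

end Residue

/-! ### Degrees of `Tor` and degrees of bases -/

namespace GradedFreeComplex

variable {K : Type u} [Field K] {n : ℕ} {F G : GradedFreeComplex K n}
  {L : Ideal (MvPolynomial (Fin n) K)}

/-- The differentials have image in `𝔪F`. -/
def IsMinimal (F : GradedFreeComplex K n) : Prop :=
  ∀ i b, F.d i (Finsupp.single b 1) ∈ maxSubmodule K n (F.B i)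

lemma mem_cycles_succ {i : ℕ} {z : F.residue (i + 1)} :
    z ∈ F.cycles (i + 1) ↔ F.residueD i z = 0 :=
  LinearMap.mem_ker

lemma homologyPart_eq_bot_iff {i : ℕ} {j : ℤ} :
    F.homologyPart i j = ⊥ ↔
      ∀ f ∈ homogeneousPart K n (F.deg i) j,
        (1 : MvPolynomial (Fin n) K ⧸ idealOfVars (Fin n) K) ⊗ₜ[MvPolynomial (Fin n) K] f
            ∈ F.cycles i →
        (1 : MvPolynomial (Fin n) K ⧸ idealOfVars (Fin n) K) ⊗ₜ[MvPolynomial (Fin n) K] f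
            ∈ LinearMap.range (F.residueD i) := by
  rw [homologyPart, eq_bot_iff]
  constructor
  · intro h f hf hz
    have := h ⟨_, ⟨hz, ⟨f, hf, rfl⟩⟩, rfl⟩
    exact (Submodule.Quotient.mk_eq_zero _).1 ((Submodule.mem_bot K).1 this)
  · rintro h _ ⟨_, ⟨hz, ⟨f, hf, rfl⟩⟩, rfl⟩
    exact (Submodule.mem_bot K).2 ((Submodule.Quotient.mk_eq_zero _).2 (h f hf hz))

/-- A degree in which `Gₖ` has no basis element is not a degree of `Tor_k`. -/
lemma IsResolution.homologyPart_eq_bot (hF : F.IsResolution L) (hG : G.IsResolution L) {k : ℕ}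
    {j : ℤ} (hj : ∀ b, G.deg k b ≠ j) : F.homologyPart k j = ⊥ := by
  obtain ⟨φ, ψ, h, gφ, -, -, h0, h1⟩ := hF.exists_homotopy hG
  rw [homologyPart_eq_bot_iff]
  intro f hf hz
  -- A nonzero constant coefficient at `b` would force `deg b = j`, which `hj` excludes.
  have hφf : φ k f ∈ maxSubmodule K n (G.B k) := by
    intro b
    rw [mem_idealOfVars_iff]
    by_contra hne
    have := (gφ k).map_mem hf b 0 (MvPolynomial.mem_support_iff.2 hne)
    rw [map_zero, Nat.cast_zero, zero_add] at this
    exact hj b this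
  have hψφ := (mk_one_eq_zero_iff _).2 (map_mem_maxSubmodule (ψ k) hφf)
  cases k with
  | zero =>
    have e : f = ψ 0 (φ 0 f) - F.d 0 (h 0 f) := by
      have := LinearMap.congr_fun h0 f
      simp only [LinearMap.comp_apply, LinearMap.sub_apply, LinearMap.id_apply] at this
      rw [this, sub_sub_cancel]
    rw [e, TensorProduct.tmul_sub, hψφ, zero_sub]
    exact neg_mem ⟨1 ⊗ₜ h 0 f, LinearMap.lTensor_tmul _ _ _ _⟩
  | succ k =>
    -- The homotopy relation solved for `f`. Modulo `𝔪` the first term vanishes by the degree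
    -- argument and the last because `f` is a cycle there, so only a boundary remains.
    have e : f = ψ (k + 1) (φ (k + 1) f) - F.d (k + 1) (h (k + 1) f) - h k (F.d k f) := by
      have := LinearMap.congr_fun (h1 k) f
      simp only [LinearMap.comp_apply, LinearMap.sub_apply, LinearMap.id_apply] at this
      rw [this]
      abel
    have hd : (1 : MvPolynomial (Fin n) K ⧸ idealOfVars (Fin n) K)
        ⊗ₜ[MvPolynomial (Fin n) K] F.d k f = 0 := by
      rw [mem_cycles_succ, residueD, LinearMap.lTensor_tmul] at hz
      exact hz
    have hhd := (mk_one_eq_zero_iff _).2 (map_mem_maxSubmodule (h k) ((mk_one_eq_zero_iff _).1 hd))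
    rw [e, TensorProduct.tmul_sub, TensorProduct.tmul_sub, hψφ, hhd, zero_sub, sub_zero]
    exact neg_mem ⟨1 ⊗ₜ h (k + 1) f, LinearMap.lTensor_tmul _ _ _ _⟩

/-- The degrees of the basis of a minimal resolution are degrees of `Tor`. -/
lemma IsMinimal.homologyPart_ne_bot (hm : F.IsMinimal) (hF : F.IsResolution L)
    (hG : G.IsResolution L) {i : ℕ} (b : F.B i) : G.homologyPart i (F.deg i b) ≠ ⊥ := by
  obtain ⟨φ, ψ, h, gφ, hφ, hψ, h0, h1⟩ := hF.exists_homotopy hG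
  rw [Ne, homologyPart_eq_bot_iff]
  intro H
  -- Minimality puts the differential of `b` into `𝔪F`, so the image of `b` in `K ⊗ G` is a cycle.
  -- If it were a boundary, then applying `ψ` and the homotopy would place `b` itself in `𝔪F`.
  have hz : (1 : MvPolynomial (Fin n) K ⧸ idealOfVars (Fin n) K)
      ⊗ₜ[MvPolynomial (Fin n) K] φ i (Finsupp.single b 1) ∈ G.cycles i := by
    cases i with
    | zero => exact Submodule.mem_top
    | succ i =>
      rw [mem_cycles_succ, residueD, LinearMap.lTensor_tmul, mk_one_eq_zero_iff]
      have := LinearMap.congr_fun (hφ i) (Finsupp.single b 1)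
      simp only [LinearMap.comp_apply] at this
      rw [this]
      exact map_mem_maxSubmodule _ (hm i b)
  obtain ⟨w, hw⟩ := H _ (gφ i b) hz
  -- `ψ` carries a boundary of `K ⊗ G` to a boundary of `K ⊗ F`, and the latter complex has zero
  -- differentials.
  have hψφ : ψ i (φ i (Finsupp.single b 1)) ∈ maxSubmodule K n (F.B i) := by
    rw [← mk_one_eq_zero_iff, ← LinearMap.lTensor_tmul, ← hw, residueD, ← LinearMap.comp_apply,
      ← LinearMap.lTensor_comp, ← hψ, LinearMap.lTensor_comp, LinearMap.comp_apply,
      lTensor_eq_zero (hm i), LinearMap.zero_apply]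
  refine single_one_notMem_maxSubmodule (K := K) (n := n) b ?_
  cases i with
  | zero =>
    have e : Finsupp.single b 1 = ψ 0 (φ 0 (Finsupp.single b 1))
        - F.d 0 (h 0 (Finsupp.single b 1)) := by
      have := LinearMap.congr_fun h0 (Finsupp.single b 1)
      simp only [LinearMap.comp_apply, LinearMap.sub_apply, LinearMap.id_apply] at this
      rw [this, sub_sub_cancel]
    rw [e]
    exact sub_mem hψφ (range_le_maxSubmodule (hm 0) _)
  | succ k =>
    have e : Finsupp.single b 1 = ψ (k + 1) (φ (k + 1) (Finsupp.single b 1))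
        - F.d (k + 1) (h (k + 1) (Finsupp.single b 1)) - h k (F.d k (Finsupp.single b 1)) := by
      have := LinearMap.congr_fun (h1 k) (Finsupp.single b 1)
      simp only [LinearMap.comp_apply, LinearMap.sub_apply, LinearMap.id_apply] at this
      rw [this]
      abel
    rw [e]
    exact sub_mem (sub_mem hψφ (range_le_maxSubmodule (hm _) _))
      (map_mem_maxSubmodule _ (hm k b))

end GradedFreeComplex

/-! ### Projective dimension and length of resolutions -/

section

variable {R M : Type u} [CommRing R] [AddCommGroup M] [Module R M] {B : Type u}

/-- Dimension shifting along `0 → Z → free → range → 0`. The bounds start at `m + 2` and `m + 1`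
because the equivalence fails one step lower: a projective range does not force `Z = 0`. -/
lemma hasProjectiveDimensionLT_range_iff (φ : (B →₀ R) →ₗ[R] M) {Z : Submodule R (B →₀ R)}
    (hZ : LinearMap.ker φ = Z) (m : ℕ) :
    HasProjectiveDimensionLT (ModuleCat.of R (LinearMap.range φ)) (m + 2) ↔
      HasProjectiveDimensionLT (ModuleCat.of R Z) (m + 1) := by
  have hs := LinearMap.shortExact_shortComplexKer (LinearMap.surjective_rangeRestrict φ)
  subst hZ
  have h := hs.hasProjectiveDimensionLT_X₃_iff m
    (ModuleCat.projective_of_categoryTheory_projective (ModuleCat.of R (B →₀ R)))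
  have e : LinearMap.ker φ.rangeRestrict = LinearMap.ker φ := LinearMap.ker_rangeRestrict φ
  rw [← e]
  exact h

lemma hasProjectiveDimensionLT_range_one (φ : (B →₀ R) →ₗ[R] M) (hφ : LinearMap.ker φ = ⊥) :
    HasProjectiveDimensionLT (ModuleCat.of R (LinearMap.range φ)) 1 := by
  rw [← projective_iff_hasProjectiveDimensionLT_one]
  have : Module.Projective R (LinearMap.range φ) :=
    Module.Projective.of_equiv (LinearEquiv.ofInjective φ (LinearMap.ker_eq_bot.1 hφ))
  exact ModuleCat.projective_of_categoryTheory_projective (ModuleCat.of R (LinearMap.range φ))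

end

namespace GradedFreeComplex

variable {K : Type u} [Field K] {n : ℕ} {F : GradedFreeComplex K n}
  {L : Ideal (MvPolynomial (Fin n) K)}

lemma IsResolution.hasProjectiveDimensionLT_iff (hF : F.IsResolution L) (i m : ℕ) :
    HasProjectiveDimensionLT (ModuleCat.of (MvPolynomial (Fin n) K) L) (m + i + 2) ↔
      HasProjectiveDimensionLT (ModuleCat.of (MvPolynomial (Fin n) K) (LinearMap.range (F.d i)))
        (m + 1) := by
  induction i generalizing m with
  | zero =>
    obtain ⟨ε, -, rfl, h, -⟩ := hF
    exact hasProjectiveDimensionLT_range_iff ε h m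
  | succ i ih =>
    rw [← hasProjectiveDimensionLT_range_iff (F.d i) (hF.exact i) m, ← ih (m + 1)]
    rw [show m + (i + 1) + 2 = m + 1 + i + 2 by ring]

/-- The differential out of the empty term is zero, so the preceding map is injective and its range,
the `p`-th syzygy module, is free. Dimension shifting carries this back to `L`. -/
lemma IsResolution.hasProjectiveDimensionLT_of_isEmpty (hF : F.IsResolution L) (p : ℕ)
    [hp : IsEmpty (F.B (p + 1))] :
    HasProjectiveDimensionLT (ModuleCat.of (MvPolynomial (Fin n) K) L) (p + 1) := by
  have h0 : LinearMap.range (F.d p) = ⊥ := by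
    rw [LinearMap.range_eq_bot]
    ext1 b
    exact hp.elim b
  cases p with
  | zero =>
    obtain ⟨ε, -, rfl, h, -⟩ := hF
    exact hasProjectiveDimensionLT_range_one ε (h.trans h0)
  | succ p =>
    have := (hF.hasProjectiveDimensionLT_iff p 0).2
      (hasProjectiveDimensionLT_range_one (F.d p) ((hF.exact p).trans h0))
    simpa using this

/-- A section `t` of `φ` makes `id - t ∘ φ` a projection onto the range of `d p`; lifting it through
`d p` gives `r` with `d p ∘ r` the identity on that range. For a basis element `e`, the vector `e -
r (d e)` is then a cycle, hence a boundary and in `𝔪F`. Also `r (d e) ∈ 𝔪F`, so `e ∈ 𝔪F`, which is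
absurd. Working with basis elements avoids Nakayama's lemma and any finiteness assumption. -/
lemma IsMinimal.isEmpty_of_projective (hm : F.IsMinimal) (hF : F.IsResolution L) (p : ℕ)
    {M : Type u} [AddCommGroup M] [Module (MvPolynomial (Fin n) K) M]
    (φ : (F.B p →₀ MvPolynomial (Fin n) K) →ₗ[MvPolynomial (Fin n) K] M)
    (hφ : LinearMap.ker φ = LinearMap.range (F.d p))
    [Module.Projective (MvPolynomial (Fin n) K) (LinearMap.range φ)] :
    IsEmpty (F.B (p + 1)) := by
  obtain ⟨t, ht⟩ := Module.projective_lifting_property φ.rangeRestrict LinearMap.id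
    (LinearMap.surjective_rangeRestrict φ)
  obtain ⟨r, hr⟩ := Module.projective_lifting_property (F.d p).rangeRestrict
    ((LinearMap.id - t ∘ₗ φ.rangeRestrict).codRestrict (LinearMap.range (F.d p)) (fun x => by
      rw [← hφ, LinearMap.mem_ker]
      have := congrArg Subtype.val (LinearMap.congr_fun ht (φ.rangeRestrict x))
      have h : φ (t (φ.rangeRestrict x)) = φ x := this
      simp [h]))
    (LinearMap.surjective_rangeRestrict _)
  refine ⟨fun b => single_one_notMem_maxSubmodule (K := K) (n := n) b ?_⟩
  set e : F.B (p + 1) →₀ MvPolynomial (Fin n) K := Finsupp.single b 1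
  have h1 : F.d p (r (F.d p e)) = F.d p e := by
    have h : F.d p (r (F.d p e)) = F.d p e - t (φ.rangeRestrict (F.d p e)) :=
      congrArg Subtype.val (LinearMap.congr_fun hr (F.d p e))
    have h2 : φ.rangeRestrict (F.d p e) = 0 := by
      rw [← LinearMap.mem_ker, LinearMap.ker_rangeRestrict, hφ]
      exact ⟨e, rfl⟩
    rw [h, h2, map_zero, sub_zero]
  have h2 : e - r (F.d p e) ∈ LinearMap.range (F.d (p + 1)) := by
    rw [← hF.exact p, LinearMap.mem_ker, map_sub, h1, sub_self]
  obtain ⟨w, hw⟩ := h2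
  have h3 := range_le_maxSubmodule (hm (p + 1)) w
  have h4 := map_mem_maxSubmodule r (hm p b)
  rw [hw] at h3
  have h5 := add_mem h3 h4
  rwa [sub_add_cancel] at h5

lemma IsMinimal.isEmpty (hm : F.IsMinimal) (hF : F.IsResolution L) (p : ℕ)
    [hp : HasProjectiveDimensionLT (ModuleCat.of (MvPolynomial (Fin n) K) L) (p + 1)] :
    IsEmpty (F.B (p + 1)) := by
  cases p with
  | zero =>
    obtain ⟨ε, -, hr, h, -⟩ := id hF
    subst hr
    have : Module.Projective (MvPolynomial (Fin n) K) (LinearMap.range ε) :=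
      (IsProjective.iff_projective _).2 (projective_iff_hasProjectiveDimensionLT_one.2 hp)
    exact hm.isEmpty_of_projective hF 0 ε h
  | succ p =>
    have h := (hF.hasProjectiveDimensionLT_iff p 0).1 (by simpa using hp)
    have : Module.Projective (MvPolynomial (Fin n) K) (LinearMap.range (F.d p)) :=
      (IsProjective.iff_projective _).2 (projective_iff_hasProjectiveDimensionLT_one.2 h)
    exact hm.isEmpty_of_projective hF (p + 1) (F.d p) (hF.exact p)

end GradedFreeComplex

/-! ### Multigraded free modules and their strands -/

section Homogenization

variable {K : Type u} [Field K] {n : ℕ} {A B C : Type u}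

/-- The vectors supported on basis elements of multidegree at most `a`. -/
abbrev strand (K : Type u) [Field K] {n : ℕ} {B : Type u} (deg : B → Fin n →₀ ℕ)
    (a : Fin n →₀ ℕ) : Submodule K (B →₀ K) :=
  Finsupp.supported K K {b | deg b ≤ a}

lemma mem_strand {deg : B → Fin n →₀ ℕ} {a : Fin n →₀ ℕ} {v : B →₀ K} :
    v ∈ strand K deg a ↔ ∀ b, v b ≠ 0 → deg b ≤ a := by
  rw [strand, Finsupp.mem_supported]
  exact ⟨fun h b hb => h (Finsupp.mem_support_iff.2 hb),
    fun h b hb => h b (Finsupp.mem_support_iff.1 hb)⟩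

/-- The element of multidegree `a` of the free module on `B` with coefficients `v`. -/
noncomputable def strandIncl (deg : B → Fin n →₀ ℕ) (a : Fin n →₀ ℕ) :
    (B →₀ K) →ₗ[K] (B →₀ MvPolynomial (Fin n) K) :=
  Finsupp.lsum K fun b => Finsupp.lsingle b ∘ₗ monomial (a - deg b)

lemma strandIncl_apply (deg : B → Fin n →₀ ℕ) (a : Fin n →₀ ℕ) (v : B →₀ K) (b : B) :
    strandIncl deg a v b = monomial (a - deg b) (v b) := by
  classical
  rw [strandIncl, Finsupp.lsum_apply, Finsupp.sum_apply, Finsupp.sum]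
  simp only [LinearMap.comp_apply, Finsupp.lsingle_apply, Finsupp.single_apply]
  rw [Finset.sum_ite_eq']
  split_ifs with h
  · rfl
  · rw [Finsupp.notMem_support_iff.1 h, map_zero]

/-- The coefficients of the component of multidegree `a`. -/
noncomputable def strandProj (deg : B → Fin n →₀ ℕ) (a : Fin n →₀ ℕ) :
    (B →₀ MvPolynomial (Fin n) K) →ₗ[K] (B →₀ K) := by
  classical
  exact Finsupp.lsum K fun b => Finsupp.lsingle b ∘ₗ
    (if deg b ≤ a then lcoeff K (a - deg b) else 0)

open Classical in
lemma strandProj_apply (deg : B → Fin n →₀ ℕ) (a : Fin n →₀ ℕ)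
    (f : B →₀ MvPolynomial (Fin n) K) (b : B) :
    strandProj deg a f b = if deg b ≤ a then coeff (a - deg b) (f b) else 0 := by
  rw [strandProj, Finsupp.lsum_apply, Finsupp.sum_apply, Finsupp.sum]
  simp only [LinearMap.comp_apply, Finsupp.lsingle_apply, Finsupp.single_apply]
  rw [Finset.sum_ite_eq']
  split_ifs with h h' h'
  · rfl
  · rfl
  · rw [Finsupp.notMem_support_iff.1 h, coeff_zero]
  · rfl

lemma strandProj_mem (deg : B → Fin n →₀ ℕ) (a : Fin n →₀ ℕ)
    (f : B →₀ MvPolynomial (Fin n) K) : strandProj deg a f ∈ strand K deg a := by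
  classical
  rw [mem_strand]
  intro b hb
  rw [strandProj_apply] at hb
  by_contra h
  exact hb (if_neg h)

lemma coeff_eq_strandProj (deg : B → Fin n →₀ ℕ) (f : B →₀ MvPolynomial (Fin n) K) (b : B)
    (m : Fin n →₀ ℕ) : coeff m (f b) = strandProj deg (m + deg b) f b := by
  classical
  rw [strandProj_apply, if_pos le_add_self, add_tsub_cancel_right]

lemma ext_strandProj (deg : B → Fin n →₀ ℕ) {f g : B →₀ MvPolynomial (Fin n) K}
    (h : ∀ a, strandProj deg a f = strandProj deg a g) : f = g := by
  ext b m
  rw [coeff_eq_strandProj deg, coeff_eq_strandProj deg, h]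

/-- Support in the strand matters: for `deg b` not below `a` the truncated exponent `a - deg b`
would give a term of multidegree other than `a`. -/
lemma strandProj_strandIncl (deg : B → Fin n →₀ ℕ) {a : Fin n →₀ ℕ} {v : B →₀ K}
    (hv : v ∈ strand K deg a) (a' : Fin n →₀ ℕ) [Decidable (a = a')] :
    strandProj deg a' (strandIncl deg a v) = if a = a' then v else 0 := by
  classical
  rw [mem_strand] at hv
  ext b
  rw [strandProj_apply, strandIncl_apply, coeff_monomial]
  by_cases hb : v b = 0
  · split_ifs <;> simp [hb]
  · have h1 := hv b hb
    by_cases h2 : a = a'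
    · subst h2
      simp [h1]
    · rw [if_neg h2]
      split_ifs with h3 h4
      · refine absurd ?_ h2
        rw [← tsub_add_cancel_of_le h1, h4, tsub_add_cancel_of_le h3]
      · rfl
      · rfl

/-- A `K`-linear map of spaces with bases that does not raise the multidegree. -/
def IsFiltered (degB : B → Fin n →₀ ℕ) (degC : C → Fin n →₀ ℕ)
    (c : (B →₀ K) →ₗ[K] (C →₀ K)) : Prop :=
  ∀ b, c (Finsupp.single b 1) ∈ strand K degC (degB b)

lemma map_mem_of_single {M : Type*} [AddCommGroup M] [Module K M] {t : Set B} {p : Submodule K M}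
    {c : (B →₀ K) →ₗ[K] M} (h : ∀ b ∈ t, c (Finsupp.single b 1) ∈ p) {v : B →₀ K}
    (hv : v ∈ Finsupp.supported K K t) : c v ∈ p := by
  rw [Finsupp.supported_eq_span_single] at hv
  have : Submodule.span K ((fun i => Finsupp.single i (1 : K)) '' t) ≤ p.comap c := by
    rw [Submodule.span_le]
    rintro _ ⟨b, hb, rfl⟩
    exact h b hb
  exact this hv

lemma strand_mono (deg : B → Fin n →₀ ℕ) {a a' : Fin n →₀ ℕ} (h : a ≤ a') :
    strand K deg a ≤ strand K deg a' :=
  Finsupp.supported_mono fun _ hb => le_trans hb h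

/-- The map of multigraded free modules of degree `0` with scalar matrix `c`. -/
noncomputable def homogenize (degB : B → Fin n →₀ ℕ) (degC : C → Fin n →₀ ℕ)
    (c : (B →₀ K) →ₗ[K] (C →₀ K)) :
    (B →₀ MvPolynomial (Fin n) K) →ₗ[MvPolynomial (Fin n) K] (C →₀ MvPolynomial (Fin n) K) :=
  Finsupp.linearCombination _ fun b => strandIncl degC (degB b) (c (Finsupp.single b 1))

lemma homogenize_single (degB : B → Fin n →₀ ℕ) (degC : C → Fin n →₀ ℕ)
    (c : (B →₀ K) →ₗ[K] (C →₀ K)) (b : B) :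
    homogenize degB degC c (Finsupp.single b 1) =
      strandIncl degC (degB b) (c (Finsupp.single b 1)) := by
  simp [homogenize]

variable {degA : A → Fin n →₀ ℕ} {degB : B → Fin n →₀ ℕ} {degC : C → Fin n →₀ ℕ}

/-- This is what reduces exactness over the polynomial ring to linear algebra over `K`: in each
multidegree the homogenized map acts as `c` itself. Filteredness ensures that no exponent is
truncated. -/
lemma IsFiltered.strandProj_homogenize {c : (B →₀ K) →ₗ[K] (C →₀ K)}
    (hc : IsFiltered degB degC c) (a : Fin n →₀ ℕ) (f : B →₀ MvPolynomial (Fin n) K) :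
    strandProj degC a (homogenize degB degC c f) = c (strandProj degB a f) := by
  classical
  induction f using Finsupp.induction_linear with
  | zero => simp only [map_zero]
  | add f g hf hg => simp only [map_add, hf, hg]
  | single b p =>
    induction p using MvPolynomial.induction_on' with
    | add p q hp hq => simp only [Finsupp.single_add, map_add, hp, hq]
    | monomial m k =>
      have h1 : strandProj degB a (Finsupp.single b (monomial m k)) =
          if m + degB b = a then k • Finsupp.single b 1 else 0 := by
        ext x
        rw [strandProj_apply]
        by_cases hx : b = x
        · subst hx
          rw [Finsupp.single_eq_same, coeff_monomial]
          split_ifs with h1 h2 h3 h4 h5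
          · simp
          · exact absurd (by rw [h2, tsub_add_cancel_of_le h1]) h3
          · exact absurd (by rw [← h4, add_tsub_cancel_right]) h2
          · rfl
          · exact absurd (h5 ▸ le_add_self) h1
          · rfl
        · rw [Finsupp.single_apply, if_neg hx, coeff_zero]
          split_ifs <;> simp [hx]
      rw [h1, apply_ite c, map_smul, map_zero]
      ext x
      rw [strandProj_apply, homogenize, Finsupp.linearCombination_single, Finsupp.smul_apply,
        strandIncl_apply, smul_eq_mul, monomial_mul, coeff_monomial]
      have hb := mem_strand.1 (hc b) x
      by_cases h0 : c (Finsupp.single b 1) x = 0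
      · split_ifs <;> simp [h0]
      · have hb := hb h0
        rw [← add_tsub_assoc_of_le hb]
        split_ifs with h1 h2 h3 h4 h5
        · simp
        · refine absurd ?_ h3
          rw [← tsub_add_cancel_of_le (le_add_left hb : degC x ≤ m + degB b), h2,
            tsub_add_cancel_of_le h1]
        · exact absurd (by rw [h4]) h2
        · simp
        · exact absurd (h5 ▸ le_add_left hb) h1
        · simp

lemma mem_range_homogenize {c : (A →₀ K) →ₗ[K] (B →₀ K)}
    (hc : IsFiltered degA degB c) (f : B →₀ MvPolynomial (Fin n) K)
    (h : ∀ a, ∃ w ∈ strand K degA a, c w = strandProj degB a f) :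
    f ∈ LinearMap.range (homogenize degA degB c) := by
  classical
  choose w hw hcw using h
  -- The finitely many multidegrees that occur in `f`; its components elsewhere are zero, so
  -- finitely many of the strandwise preimages suffice.
  let T : Finset (Fin n →₀ ℕ) :=
    f.support.biUnion fun b => (f b).support.image fun m => m + degB b
  refine ⟨∑ a ∈ T, strandIncl degA a (w a), ext_strandProj degB fun a => ?_⟩
  rw [hc.strandProj_homogenize, map_sum,
    Finset.sum_congr rfl (fun x _ => strandProj_strandIncl degA (hw x) a), Finset.sum_ite_eq']
  split_ifs with h
  · exact hcw a
  · rw [map_zero]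
    ext b
    rw [strandProj_apply]
    split_ifs with hb
    · by_contra hne
      refine h (Finset.mem_biUnion.2 ⟨b, ?_, Finset.mem_image.2
        ⟨a - degB b, ?_, tsub_add_cancel_of_le hb⟩⟩)
      · rw [Finsupp.mem_support_iff]
        rintro h0
        simp [h0] at hne
      · rw [mem_support_iff]
        exact fun h0 => hne h0.symm
    · rfl

lemma ker_homogenize_eq_range {c : (A →₀ K) →ₗ[K] (B →₀ K)} {c' : (B →₀ K) →ₗ[K] (C →₀ K)}
    (hc : IsFiltered degA degB c) (hc' : IsFiltered degB degC c') (h0 : c' ∘ₗ c = 0)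
    (h : ∀ a, ∀ v ∈ strand K degB a, c' v = 0 → ∃ w ∈ strand K degA a, c w = v) :
    LinearMap.ker (homogenize degB degC c') = LinearMap.range (homogenize degA degB c) := by
  apply le_antisymm
  · intro f hf
    refine mem_range_homogenize hc f fun a => h a _ (strandProj_mem _ _ _) ?_
    rw [← hc'.strandProj_homogenize, LinearMap.mem_ker.1 hf, map_zero]
  · rintro _ ⟨f, rfl⟩
    refine LinearMap.mem_ker.2 (ext_strandProj degC fun a => ?_)
    rw [hc'.strandProj_homogenize, hc.strandProj_homogenize, ← LinearMap.comp_apply, h0,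
      LinearMap.zero_apply, map_zero]

lemma strandIncl_mem_homogeneousPart {a : Fin n →₀ ℕ} {v : B →₀ K} (hv : v ∈ strand K degB a) :
    strandIncl degB a v ∈ homogeneousPart K n (fun b => ((Finsupp.degree (degB b) : ℕ) : ℤ))
      ((Finsupp.degree a : ℕ) : ℤ) := by
  classical
  intro b m hm
  rw [strandIncl_apply, mem_support_iff, coeff_monomial] at hm
  split_ifs at hm with h
  · have := mem_strand.1 hv b hm
    rw [← h, ← Nat.cast_add, ← map_add, tsub_add_cancel_of_le this]
  · exact absurd rfl hm

end Homogenization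

/-! ### Multigraded complexes and exactness by contractions -/

/-- A complex of multigraded free modules over `K[x₁, …, xₙ]` with an augmentation to the ring, given
by the basis `B` of all its terms together, the homological degrees `h` and the multidegrees `deg`
of the basis elements, and the scalar matrices `d`, `ε` of the differential and the augmentation. -/
structure MultigradedComplex (K : Type u) [Field K] (n : ℕ) where
  /-- the multihomogeneous basis -/
  B : Type u
  /-- the homological degrees -/
  h : B → ℕ
  /-- the multidegrees -/
  deg : B → Fin n →₀ ℕ
  /-- the matrix of the differential -/
  d : (B →₀ K) →ₗ[K] (B →₀ K)
  /-- the matrix of the augmentation -/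
  ε : (B →₀ K) →ₗ[K] K
  d_mem : ∀ b, d (Finsupp.single b 1) ∈
    Finsupp.supported K K {b' | deg b' ≤ deg b ∧ h b' + 1 = h b}
  d_d : ∀ v, d (d v) = 0
  ε_d : ∀ v, ε (d v) = 0
  ε_single : ∀ b, h b ≠ 0 → ε (Finsupp.single b 1) = 0

namespace MultigradedComplex

variable {K : Type u} [Field K] {n : ℕ}

/-- All strands are exact except that the augmentation has image `K` in the multidegrees of the
monomials of `I`; exactness is witnessed by contractions. -/
def Resolves (X : MultigradedComplex K n) (I : Ideal (MvPolynomial (Fin n) K)) : Prop :=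
  ∀ a : Fin n →₀ ℕ, ∃ (s : (X.B →₀ K) →ₗ[K] (X.B →₀ K)) (e : X.B →₀ K),
    (∀ b, X.deg b ≤ a → s (Finsupp.single b 1) ∈
      Finsupp.supported K K {b' | X.deg b' ≤ a ∧ X.h b' = X.h b + 1}) ∧
    e ∈ Finsupp.supported K K {b' | X.deg b' ≤ a ∧ X.h b' = 0} ∧
    (∀ b, X.deg b ≤ a → X.d (s (Finsupp.single b 1)) + s (X.d (Finsupp.single b 1)) =
      Finsupp.single b 1 - X.ε (Finsupp.single b 1) • e) ∧
    (monomial a (1 : K) ∈ I → X.ε e = 1) ∧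
    (monomial a (1 : K) ∉ I → ∀ b, X.deg b ≤ a → X.ε (Finsupp.single b 1) = 0)

variable (X : MultigradedComplex K n)

/-- The inclusion of the part of homological degree `i`. -/
noncomputable def incl (i : ℕ) : ({b | X.h b = i} →₀ K) →ₗ[K] (X.B →₀ K) :=
  Finsupp.lmapDomain K K Subtype.val

/-- The projection to the part of homological degree `i`. -/
noncomputable def proj (i : ℕ) : (X.B →₀ K) →ₗ[K] ({b | X.h b = i} →₀ K) :=
  Finsupp.lsubtypeDomain {b | X.h b = i}

lemma incl_single (i : ℕ) (b : {b | X.h b = i}) (k : K) :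
    X.incl i (Finsupp.single b k) = Finsupp.single b.1 k := by
  simp [incl]

lemma proj_apply (i : ℕ) (v : X.B →₀ K) (b : {b | X.h b = i}) : X.proj i v b = v b.1 := rfl

lemma incl_apply (i : ℕ) (v : {b | X.h b = i} →₀ K) (b : {b | X.h b = i}) :
    X.incl i v b.1 = v b :=
  Finsupp.mapDomain_apply Subtype.val_injective v b

lemma proj_incl (i : ℕ) (v : {b | X.h b = i} →₀ K) : X.proj i (X.incl i v) = v := by
  ext b
  rw [proj_apply, incl_apply]

lemma incl_proj (i : ℕ) {v : X.B →₀ K} (hv : v ∈ Finsupp.supported K K {b | X.h b = i}) :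
    X.incl i (X.proj i v) = v := by
  ext b
  by_cases hb : X.h b = i
  · exact X.incl_apply i _ ⟨b, hb⟩
  · rw [Finsupp.notMem_support_iff.1 (fun h => hb (hv h))]
    refine Finsupp.mapDomain_of_notMem_range _ _ ?_
    rintro ⟨b', rfl⟩
    exact hb b'.2

lemma incl_mem_h (i : ℕ) (v : {b | X.h b = i} →₀ K) :
    X.incl i v ∈ Finsupp.supported K K {b | X.h b = i} := by
  refine map_mem_of_single (t := Set.univ) (fun b _ => ?_) (Set.subset_univ _)
  rw [incl_single]
  exact Finsupp.single_mem_supported K _ b.2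

lemma incl_mem_strand (i : ℕ) {a : Fin n →₀ ℕ} {v : {b | X.h b = i} →₀ K}
    (hv : v ∈ strand K (fun b : {b | X.h b = i} => X.deg b.1) a) :
    X.incl i v ∈ Finsupp.supported K K {b | X.deg b ≤ a ∧ X.h b = i} := by
  refine map_mem_of_single (fun b hb => ?_) hv
  rw [incl_single]
  exact Finsupp.single_mem_supported K _ ⟨hb, b.2⟩

lemma proj_mem_strand (i : ℕ) {a : Fin n →₀ ℕ} {v : X.B →₀ K} (hv : v ∈ strand K X.deg a) :
    X.proj i v ∈ strand K (fun b : {b | X.h b = i} => X.deg b.1) a :=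
  mem_strand.2 fun b hb => mem_strand.1 hv b.1 hb

/-- The matrix of the differential from homological degree `i + 1` to `i`. -/
noncomputable def dMatrix (i : ℕ) :
    ({b | X.h b = i + 1} →₀ K) →ₗ[K] ({b | X.h b = i} →₀ K) :=
  X.proj i ∘ₗ X.d ∘ₗ X.incl (i + 1)

lemma d_mem_h {i : ℕ} {v : X.B →₀ K} (hv : v ∈ Finsupp.supported K K {b | X.h b = i + 1}) :
    X.d v ∈ Finsupp.supported K K {b | X.h b = i} := by
  refine map_mem_of_single (fun b hb => ?_) hv
  refine Finsupp.supported_mono (fun b' hb' => ?_) (X.d_mem b)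
  have h1 : X.h b = i + 1 := hb
  have h2 := hb'.2
  change X.h b' = i
  omega

lemma incl_dMatrix (i : ℕ) (v : {b | X.h b = i + 1} →₀ K) :
    X.incl i (X.dMatrix i v) = X.d (X.incl (i + 1) v) :=
  X.incl_proj i (X.d_mem_h (X.incl_mem_h (i + 1) v))

lemma dMatrix_comp_dMatrix (i : ℕ) : X.dMatrix i ∘ₗ X.dMatrix (i + 1) = 0 :=
  LinearMap.ext fun v => by
    change X.proj i (X.d (X.incl (i + 1) (X.dMatrix (i + 1) v))) = 0
    rw [incl_dMatrix, d_d, map_zero]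

lemma isFiltered_dMatrix (i : ℕ) :
    IsFiltered (fun b : {b | X.h b = i + 1} => X.deg b.1) (fun b : {b | X.h b = i} => X.deg b.1)
      (X.dMatrix i) := by
  intro b
  refine X.proj_mem_strand i ?_
  rw [LinearMap.comp_apply, incl_single]
  exact Finsupp.supported_mono (fun b' hb' => hb'.1) (X.d_mem b.1)

/-- The graded free complex with matrices `X.d`. -/
noncomputable def toGraded : GradedFreeComplex K n where
  B i := {b | X.h b = i}
  deg i b := ((Finsupp.degree (X.deg b.1) : ℕ) : ℤ)
  d i := homogenize (fun b : {b | X.h b = i + 1} => X.deg b.1) (fun b => X.deg b.1) (X.dMatrix i)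
  d_homogeneous i b := by
    rw [homogenize_single]
    exact strandIncl_mem_homogeneousPart (X.isFiltered_dMatrix i b)
  d_comp_d i := LinearMap.ext fun f => ext_strandProj (fun b => X.deg b.1) fun a => by
    rw [LinearMap.comp_apply, (X.isFiltered_dMatrix i).strandProj_homogenize,
      (X.isFiltered_dMatrix (i + 1)).strandProj_homogenize, ← LinearMap.comp_apply,
      dMatrix_comp_dMatrix, LinearMap.zero_apply, LinearMap.zero_apply, map_zero]

/-- The matrix of the augmentation. -/
noncomputable def εMatrix : ({b | X.h b = 0} →₀ K) →ₗ[K] (PUnit.{u + 1} →₀ K) :=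
  Finsupp.lsingle PUnit.unit ∘ₗ X.ε ∘ₗ X.incl 0

lemma isFiltered_εMatrix :
    IsFiltered (fun b : {b | X.h b = 0} => X.deg b.1) (fun _ => 0) X.εMatrix :=
  fun _ => mem_strand.2 fun _ _ => zero_le

variable {X}

lemma Resolves.exists_of_d_eq_zero {I : Ideal (MvPolynomial (Fin n) K)} (hX : X.Resolves I)
    {i : ℕ} {a : Fin n →₀ ℕ} {v : X.B →₀ K}
    (hv : v ∈ Finsupp.supported K K {b | X.deg b ≤ a ∧ X.h b = i}) (hd : X.d v = 0)
    (hε : X.ε v = 0) :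
    ∃ w ∈ Finsupp.supported K K {b | X.deg b ≤ a ∧ X.h b = i + 1}, X.d w = v := by
  obtain ⟨s, e, h1, -, h3, -, -⟩ := hX a
  refine ⟨s v, map_mem_of_single (fun b hb => ?_) hv, ?_⟩
  · rw [← hb.2]
    exact h1 b hb.1
  · let c : (X.B →₀ K) →ₗ[K] (X.B →₀ K) :=
      X.d ∘ₗ s + s ∘ₗ X.d - LinearMap.id + X.ε.smulRight e
    have h : c v ∈ (⊥ : Submodule K (X.B →₀ K)) :=
      map_mem_of_single (fun b hb => by
        have := h3 b hb.1
        simp only [c]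
        simp only [LinearMap.add_apply, LinearMap.sub_apply, LinearMap.comp_apply,
          LinearMap.id_apply, LinearMap.smulRight_apply, Submodule.mem_bot]
        rw [this]
        abel) hv
    simp only [c, LinearMap.add_apply, LinearMap.sub_apply, LinearMap.comp_apply,
      LinearMap.id_apply, LinearMap.smulRight_apply, Submodule.mem_bot, hd, hε, map_zero,
      zero_smul, add_zero] at h
    exact sub_eq_zero.1 h

lemma Resolves.dMatrix_exact {I : Ideal (MvPolynomial (Fin n) K)} (hX : X.Resolves I) {i : ℕ}
    {a : Fin n →₀ ℕ} {v : {b | X.h b = i} →₀ K}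
    (hv : v ∈ strand K (fun b : {b | X.h b = i} => X.deg b.1) a)
    (hd : X.d (X.incl i v) = 0) (hε : X.ε (X.incl i v) = 0) :
    ∃ w ∈ strand K (fun b : {b | X.h b = i + 1} => X.deg b.1) a, X.dMatrix i w = v := by
  obtain ⟨w, hw, hdw⟩ := hX.exists_of_d_eq_zero (X.incl_mem_strand i hv) hd hε
  refine ⟨X.proj (i + 1) w, X.proj_mem_strand _ (Finsupp.supported_mono (fun b hb => hb.1) hw), ?_⟩
  rw [dMatrix, LinearMap.comp_apply, LinearMap.comp_apply,
    X.incl_proj _ (Finsupp.supported_mono (fun b hb => hb.2) hw), hdw, proj_incl]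

lemma ε_eq_zero {i : ℕ} {v : X.B →₀ K} (hv : v ∈ Finsupp.supported K K {b | X.h b = i + 1}) :
    X.ε v = 0 := by
  have : X.ε v ∈ (⊥ : Submodule K K) := map_mem_of_single (fun b hb => by
    have hb : X.h b = i + 1 := hb
    exact X.ε_single b (by omega)) hv
  simpa using this

lemma d_eq_zero {v : X.B →₀ K} (hv : v ∈ Finsupp.supported K K {b | X.h b = 0}) :
    X.d v = 0 := by
  have : X.d v ∈ (⊥ : Submodule K _) := map_mem_of_single (fun b hb => by
    have hb : X.h b = 0 := hb
    have := X.d_mem b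
    rwa [show {b' | X.deg b' ≤ X.deg b ∧ X.h b' + 1 = X.h b} = ∅ by
      ext b'; simp [hb], Finsupp.supported_empty] at this) hv
  simpa using this

variable (X) in
/-- The augmentation of the homogenization. -/
noncomputable def augmentation :
    ({b | X.h b = 0} →₀ MvPolynomial (Fin n) K) →ₗ[MvPolynomial (Fin n) K]
      MvPolynomial (Fin n) K :=
  Finsupp.lapply PUnit.unit ∘ₗ homogenize (fun b : {b | X.h b = 0} => X.deg b.1)
    (fun _ => 0) X.εMatrix

lemma augmentation_apply (f : {b | X.h b = 0} →₀ MvPolynomial (Fin n) K) :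
    X.augmentation f = homogenize (fun b : {b | X.h b = 0} => X.deg b.1)
      (fun _ => 0) X.εMatrix f PUnit.unit := rfl

lemma εMatrix_apply (v : {b | X.h b = 0} →₀ K) (x : PUnit.{u + 1}) :
    X.εMatrix v x = X.ε (X.incl 0 v) := by
  change Finsupp.single PUnit.unit (X.ε (X.incl 0 v)) x = _
  rw [Finsupp.single_eq_same]

lemma Resolves.range_augmentation {I : Ideal (MvPolynomial (Fin n) K)} (hX : X.Resolves I)
    (hI : ∀ f, f ∈ I ↔ ∀ m ∈ f.support, monomial m (1 : K) ∈ I) :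
    LinearMap.range X.augmentation = I := by
  classical
  ext f
  constructor
  · rintro ⟨g, rfl⟩
    rw [hI]
    intro m hm
    by_contra hmI
    obtain ⟨-, -, -, -, -, -, h5⟩ := hX m
    have h5 := h5 hmI
    rw [mem_support_iff, augmentation_apply,
      coeff_eq_strandProj (fun _ => 0), X.isFiltered_εMatrix.strandProj_homogenize, add_zero,
      εMatrix_apply] at hm
    have : X.ε (X.incl 0 (strandProj (fun b : {b | X.h b = 0} => X.deg b.1) m g))
        ∈ (⊥ : Submodule K K) := map_mem_of_single (fun b hb => h5 b hb.1)
          (X.incl_mem_strand 0 (strandProj_mem _ m g))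
    exact hm this
  · intro hf
    obtain ⟨g, hg⟩ := mem_range_homogenize X.isFiltered_εMatrix
      (Finsupp.single PUnit.unit f) (fun a => by
        obtain ⟨-, e, -, h2, -, h4, -⟩ := hX a
        by_cases ha : monomial a (1 : K) ∈ I
        -- Since `ε e = 1`, scaling `e` by the coefficient of `x^a` in `f` hits that component of
        -- `f`.
        · refine ⟨coeff a f • X.proj 0 e, Submodule.smul_mem _ _ (X.proj_mem_strand 0
            (Finsupp.supported_mono (fun b hb => hb.1) h2)), ?_⟩
          refine Finsupp.ext fun x => ?_
          rw [εMatrix_apply, map_smul, map_smul,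
            X.incl_proj 0 (Finsupp.supported_mono (fun b hb => hb.2) h2), h4 ha,
            strandProj_apply, if_pos zero_le, tsub_zero, Finsupp.single_eq_same, smul_eq_mul,
            mul_one]
        · refine ⟨0, zero_mem _, ?_⟩
          refine Finsupp.ext fun x => ?_
          rw [strandProj_apply, if_pos zero_le, tsub_zero, Finsupp.single_eq_same,
            εMatrix_apply, map_zero, map_zero]
          by_contra hne
          exact ha ((hI f).1 hf a (mem_support_iff.2 (Ne.symm hne))))
    refine ⟨g, ?_⟩
    rw [augmentation_apply, hg, Finsupp.single_eq_same]

lemma Resolves.ker_augmentation {I : Ideal (MvPolynomial (Fin n) K)} (hX : X.Resolves I) :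
    LinearMap.ker X.augmentation = LinearMap.range (homogenize
      (fun b : {b | X.h b = 0 + 1} => X.deg b.1) (fun b : {b | X.h b = 0} => X.deg b.1)
      (X.dMatrix 0)) := by
  refine Eq.trans ?_ (ker_homogenize_eq_range (X.isFiltered_dMatrix 0) X.isFiltered_εMatrix
    (LinearMap.ext fun v => Finsupp.ext fun x => ?_) (fun a v hv h0 => ?_))
  · ext f
    simp only [LinearMap.mem_ker, augmentation_apply]
    exact ⟨fun h => Finsupp.ext fun x => h, fun h => by rw [h]; rfl⟩
  · rw [LinearMap.comp_apply, εMatrix_apply, incl_dMatrix, ε_d, LinearMap.zero_apply,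
      Finsupp.zero_apply]
  · refine hX.dMatrix_exact hv (d_eq_zero (X.incl_mem_h 0 v)) ?_
    rw [← εMatrix_apply v PUnit.unit, h0, Finsupp.zero_apply]

variable (X) in
lemma degree_augmentation (b : {b | X.h b = 0}) {m : Fin n →₀ ℕ}
    (hm : m ∈ (X.augmentation (Finsupp.single b 1)).support) :
    ((Finsupp.degree m : ℕ) : ℤ) = ((Finsupp.degree (X.deg b.1) : ℕ) : ℤ) := by
  rw [augmentation_apply, homogenize_single] at hm
  have := strandIncl_mem_homogeneousPart (X.isFiltered_εMatrix b) PUnit.unit m hm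
  simpa using this

/-- The homogenization of exact strands is a resolution. -/
lemma Resolves.isResolution {I : Ideal (MvPolynomial (Fin n) K)} (hX : X.Resolves I)
    (hI : ∀ f, f ∈ I ↔ ∀ m ∈ f.support, monomial m (1 : K) ∈ I) :
    X.toGraded.IsResolution I := by
  refine ⟨X.augmentation, fun b m hm => ?_, hX.range_augmentation hI, hX.ker_augmentation,
    fun i => ?_⟩
  · exact X.degree_augmentation b hm
  · refine ker_homogenize_eq_range (X.isFiltered_dMatrix (i + 1)) (X.isFiltered_dMatrix i)
      (X.dMatrix_comp_dMatrix i) (fun a v hv h0 => ?_)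
    refine hX.dMatrix_exact hv ?_ (ε_eq_zero (X.incl_mem_h (i + 1) v))
    rw [← incl_dMatrix, h0, map_zero]

variable (X) in
/-- No entry of the differential is a unit. -/
def IsMinimal : Prop :=
  ∀ b b', X.d (Finsupp.single b 1) b' ≠ 0 → X.deg b' ≠ X.deg b

/-- The entries are scalar multiples of monomials `x^(deg b - deg b')`, constant only when the
multidegrees agree, and minimality excludes nonzero entries there. -/
lemma IsMinimal.homogenize_mem (hX : X.IsMinimal) (i : ℕ) (b : {b | X.h b = i + 1}) :
    homogenize (fun b : {b | X.h b = i + 1} => X.deg b.1) (fun b : {b | X.h b = i} => X.deg b.1)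
      (X.dMatrix i) (Finsupp.single b 1) ∈ maxSubmodule K n {b | X.h b = i} := by
  classical
  intro b'
  rw [mem_idealOfVars_iff, homogenize_single, strandIncl_apply, coeff_monomial]
  split_ifs with h
  · by_contra hne
    have h1 : X.dMatrix i (Finsupp.single b 1) b' = X.d (Finsupp.single b.1 1) b'.1 := by
      rw [← incl_single, ← incl_dMatrix, incl_apply]
    have h2 := mem_strand.1 (X.isFiltered_dMatrix i b) b' hne
    rw [h1] at hne
    exact hX _ _ hne (le_antisymm h2 (tsub_eq_zero_iff_le.1 h))
  · rfl

lemma IsMinimal.toGraded (hX : X.IsMinimal) : X.toGraded.IsMinimal :=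
  hX.homogenize_mem

end MultigradedComplex

lemma IsMonomialIdeal.mem_iff {K : Type u} [Field K] {n : ℕ} {I : Ideal (MvPolynomial (Fin n) K)}
    (hI : IsMonomialIdeal I) (f : MvPolynomial (Fin n) K) :
    f ∈ I ↔ ∀ m ∈ f.support, monomial m (1 : K) ∈ I := by
  classical
  obtain ⟨A, rfl⟩ := hI
  rw [mem_ideal_span_monomial_image]
  refine forall₂_congr fun m _ => ?_
  rw [mem_ideal_span_monomial_image]
  simp [support_monomial]

/-! ### The lcm product of multigraded complexes -/

section Product

variable {K : Type u} [Field K] {B C : Type u}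

/-- The tensor product of vectors with bases. -/
noncomputable def tmulVec : (B →₀ K) →ₗ[K] (C →₀ K) →ₗ[K] (B × C →₀ K) :=
  (TensorProduct.mk K (B →₀ K) (C →₀ K)).compr₂ (finsuppTensorFinsupp' K B C).toLinearMap

lemma tmulVec_single (b : B) (c : C) :
    tmulVec (Finsupp.single b (1 : K)) (Finsupp.single c 1) = Finsupp.single (b, c) 1 := by
  simp [tmulVec]

lemma tmulVec_mem {s : Set B} {t : Set C} {r : Set (B × C)}
    (h : ∀ b ∈ s, ∀ c ∈ t, (b, c) ∈ r) {v : B →₀ K} {w : C →₀ K}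
    (hv : v ∈ Finsupp.supported K K s) (hw : w ∈ Finsupp.supported K K t) :
    tmulVec v w ∈ Finsupp.supported K K r := by
  have : tmulVec.flip w v ∈ Finsupp.supported K K r :=
    map_mem_of_single (fun b hb => by
      rw [LinearMap.flip_apply]
      refine map_mem_of_single (fun c hc => ?_) hw
      rw [tmulVec_single]
      exact Finsupp.single_mem_supported K _ (h b hb c hc)) hv
  exact this

end Product

namespace MultigradedComplex

variable {K : Type u} [Field K] {n : ℕ}

/-- The sign `(-1)^h`. -/
noncomputable def sign (X : MultigradedComplex K n) : (X.B →₀ K) →ₗ[K] (X.B →₀ K) :=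
  Finsupp.linearCombination K fun b => Finsupp.single b ((-1) ^ X.h b)

lemma sign_single (X : MultigradedComplex K n) (b : X.B) :
    X.sign (Finsupp.single b 1) = (-1 : K) ^ X.h b • Finsupp.single b 1 := by
  simp [sign]

lemma sign_of_mem (X : MultigradedComplex K n) {i : ℕ} {v : X.B →₀ K}
    (hv : v ∈ Finsupp.supported K K {b | X.h b = i}) : X.sign v = (-1 : K) ^ i • v := by
  let c : (X.B →₀ K) →ₗ[K] (X.B →₀ K) := X.sign - (-1 : K) ^ i • LinearMap.id
  have h : c v ∈ (⊥ : Submodule K (X.B →₀ K)) := map_mem_of_single (fun b hb => by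
    have hb : X.h b = i := hb
    simp only [c, LinearMap.sub_apply, LinearMap.smul_apply, LinearMap.id_apply]
    rw [sign_single, hb, sub_self]
    exact zero_mem _) hv
  exact sub_eq_zero.1 h

lemma sign_d (X : MultigradedComplex K n) (v : X.B →₀ K) : X.sign (X.d v) = -X.d (X.sign v) := by
  have : X.sign ∘ₗ X.d = -(X.d ∘ₗ X.sign) := by
    refine Finsupp.lhom_ext' fun b => LinearMap.ext_ring ?_
    have h := X.d_mem b
    change X.sign (X.d (Finsupp.single b 1)) = -X.d (X.sign (Finsupp.single b 1))
    rw [sign_single, map_smul]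
    cases hb : X.h b with
    | zero =>
      rw [d_eq_zero (Finsupp.single_mem_supported K _ hb)]
      simp
    | succ i =>
      rw [X.sign_of_mem (i := i) (Finsupp.supported_mono (fun b' hb' => by
        have := hb'.2
        change X.h b' = i
        omega) h), pow_succ]
      simp
  exact LinearMap.congr_fun this v

lemma ε_sign (X : MultigradedComplex K n) (v : X.B →₀ K) : X.ε (X.sign v) = X.ε v := by
  have : X.ε ∘ₗ X.sign = X.ε := by
    refine Finsupp.lhom_ext' fun b => LinearMap.ext_ring ?_
    change X.ε (X.sign (Finsupp.single b 1)) = X.ε (Finsupp.single b 1)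
    rw [sign_single, map_smul]
    by_cases hb : X.h b = 0
    · rw [hb, pow_zero, one_smul]
    · rw [X.ε_single b hb, smul_zero]
  exact LinearMap.congr_fun this v

variable (X Y : MultigradedComplex K n)

/-- The differential of the product. -/
noncomputable def prodD : (X.B × Y.B →₀ K) →ₗ[K] (X.B × Y.B →₀ K) :=
  Finsupp.linearCombination K fun p => tmulVec (X.d (Finsupp.single p.1 1)) (Finsupp.single p.2 1) +
    tmulVec (X.sign (Finsupp.single p.1 1)) (Y.d (Finsupp.single p.2 1))

lemma bilin_ext {B C M : Type*} [AddCommGroup M] [Module K M]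
    {f g : (B →₀ K) →ₗ[K] (C →₀ K) →ₗ[K] M}
    (h : ∀ b c, f (Finsupp.single b 1) (Finsupp.single c 1) =
      g (Finsupp.single b 1) (Finsupp.single c 1)) : f = g :=
  Finsupp.lhom_ext' fun b => LinearMap.ext_ring (Finsupp.lhom_ext' fun c => LinearMap.ext_ring
    (h b c))

lemma prodD_tmulVec (x : X.B →₀ K) (y : Y.B →₀ K) :
    X.prodD Y (tmulVec x y) = tmulVec (X.d x) y + tmulVec (X.sign x) (Y.d y) := by
  have : tmulVec.compr₂ (X.prodD Y) =
      tmulVec.compl₁₂ X.d LinearMap.id + tmulVec.compl₁₂ X.sign Y.d := by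
    refine bilin_ext fun b c => ?_
    simp only [LinearMap.compr₂_apply, tmulVec_single, LinearMap.add_apply,
      LinearMap.compl₁₂_apply, LinearMap.id_apply]
    rw [prodD, Finsupp.linearCombination_single, one_smul]
  exact LinearMap.congr_fun₂ this x y

/-- The augmentation of the product. -/
noncomputable def prodε : (X.B × Y.B →₀ K) →ₗ[K] K :=
  Finsupp.linearCombination K fun p => X.ε (Finsupp.single p.1 1) * Y.ε (Finsupp.single p.2 1)

lemma prodε_tmulVec (x : X.B →₀ K) (y : Y.B →₀ K) :
    X.prodε Y (tmulVec x y) = X.ε x * Y.ε y := by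
  have : tmulVec.compr₂ (X.prodε Y) = (LinearMap.mul K K).compl₁₂ X.ε Y.ε := by
    refine bilin_ext fun b c => ?_
    simp only [LinearMap.compr₂_apply, tmulVec_single, LinearMap.compl₁₂_apply,
      LinearMap.mul_apply']
    rw [prodε, Finsupp.linearCombination_single, one_smul]
  exact LinearMap.congr_fun₂ this x y

lemma ext_prod {M : Type*} [AddCommGroup M] [Module K M] {f g : (X.B × Y.B →₀ K) →ₗ[K] M}
    (h : ∀ b c, f (tmulVec (Finsupp.single b 1) (Finsupp.single c 1)) =
      g (tmulVec (Finsupp.single b 1) (Finsupp.single c 1))) : f = g :=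
  Finsupp.lhom_ext' fun p => LinearMap.ext_ring (by
    have := h p.1 p.2
    rwa [tmulVec_single] at this)

/-- The product of two complexes: the basis elements are the pairs, and the multidegree of a pair is
the least common multiple. -/
noncomputable def prod : MultigradedComplex K n where
  B := X.B × Y.B
  h p := X.h p.1 + Y.h p.2
  deg p := X.deg p.1 ⊔ Y.deg p.2
  d := X.prodD Y
  ε := X.prodε Y
  d_mem := fun p => by
    rw [← tmulVec_single p.1 p.2, prodD_tmulVec, sign_single]
    refine add_mem (tmulVec_mem ?_ (X.d_mem p.1)
      (Finsupp.single_mem_supported K _ (Set.mem_singleton p.2)))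
      (tmulVec_mem ?_ (Submodule.smul_mem _ _
        (Finsupp.single_mem_supported K _ (Set.mem_singleton p.1))) (Y.d_mem p.2))
    -- Replacing one factor by a divisor replaces the lcm by a divisor.
    · rintro b ⟨hb, hb'⟩ c rfl
      refine ⟨sup_le_sup_right hb _, ?_⟩
      simp only
      omega
    · rintro b rfl c ⟨hb, hb'⟩
      refine ⟨sup_le_sup_left hb _, ?_⟩
      simp only
      omega
  d_d v := by
    -- The two mixed terms cancel because the sign anticommutes with `d`.
    have : X.prodD Y ∘ₗ X.prodD Y = 0 := X.ext_prod Y fun b c => by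
      rw [LinearMap.comp_apply, prodD_tmulVec, map_add, prodD_tmulVec, prodD_tmulVec, d_d, d_d,
        sign_d]
      simp
    exact LinearMap.congr_fun this v
  ε_d v := by
    have : X.prodε Y ∘ₗ X.prodD Y = 0 := X.ext_prod Y fun b c => by
      rw [LinearMap.comp_apply, prodD_tmulVec, map_add, prodε_tmulVec, prodε_tmulVec, ε_d, ε_d]
      simp
    exact LinearMap.congr_fun this v
  ε_single := fun p hp => by
    rw [← tmulVec_single p.1 p.2, prodε_tmulVec]
    by_cases h : X.h p.1 = 0
    · rw [Y.ε_single p.2 (by omega), mul_zero]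
    · rw [X.ε_single p.1 h, zero_mul]

variable {X Y}

/-- The homotopy `s ⊗ 1 + ε e ⊗ s'` on the product. -/
noncomputable def prodHomotopy (X Y : MultigradedComplex K n) (s : (X.B →₀ K) →ₗ[K] (X.B →₀ K))
    (e : X.B →₀ K) (s' : (Y.B →₀ K) →ₗ[K] (Y.B →₀ K)) :
    (X.B × Y.B →₀ K) →ₗ[K] (X.B × Y.B →₀ K) :=
  Finsupp.linearCombination K fun p => tmulVec (s (Finsupp.single p.1 1)) (Finsupp.single p.2 1) +
    X.ε (Finsupp.single p.1 1) • tmulVec e (s' (Finsupp.single p.2 1))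

lemma prodHomotopy_tmulVec (s : (X.B →₀ K) →ₗ[K] (X.B →₀ K))
    (e : X.B →₀ K) (s' : (Y.B →₀ K) →ₗ[K] (Y.B →₀ K)) (x : X.B →₀ K) (y : Y.B →₀ K) :
    X.prodHomotopy Y s e s' (tmulVec x y) = tmulVec (s x) y + X.ε x • tmulVec e (s' y) := by
  have : tmulVec.compr₂ (X.prodHomotopy Y s e s') =
      tmulVec.compl₁₂ s LinearMap.id + tmulVec.compl₁₂ (X.ε.smulRight e) s' := by
    refine bilin_ext fun b c => ?_
    simp only [LinearMap.compr₂_apply, tmulVec_single, LinearMap.add_apply,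
      LinearMap.compl₁₂_apply, LinearMap.id_apply, LinearMap.smulRight_apply, map_smul,
      LinearMap.smul_apply]
    rw [prodHomotopy, Finsupp.linearCombination_single, one_smul]
  have h := LinearMap.congr_fun₂ this x y
  simpa using h

/-- The strands of the product are the tensor products of the strands. -/
lemma Resolves.prod {I J : Ideal (MvPolynomial (Fin n) K)} (hX : X.Resolves I)
    (hY : Y.Resolves J) : (X.prod Y).Resolves (I ⊓ J) := by
  intro a
  obtain ⟨s, e, h1, h2, h3, h4, h5⟩ := hX a
  obtain ⟨s', e', h1', h2', h3', h4', h5'⟩ := hY a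
  have he : X.d e = 0 := d_eq_zero (Finsupp.supported_mono (fun b hb => hb.2) h2)
  have hs : X.sign e = e := by
    rw [X.sign_of_mem (Finsupp.supported_mono (fun b hb => hb.2) h2), pow_zero, one_smul]
  refine ⟨X.prodHomotopy Y s e s', tmulVec e e', ?_, ?_, ?_, ?_, ?_⟩
  · rintro ⟨b, c⟩ hp
    -- The lcm divides `x^a` exactly when both multidegrees do; this makes the strand of the product
    -- a tensor product of strands.
    obtain ⟨hb, hc⟩ := sup_le_iff.1 hp
    suffices h : X.prodHomotopy Y s e s' (tmulVec (Finsupp.single b 1) (Finsupp.single c 1)) ∈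
        Finsupp.supported K K {p : X.B × Y.B | X.deg p.1 ⊔ Y.deg p.2 ≤ a ∧
          X.h p.1 + Y.h p.2 = X.h b + Y.h c + 1} by
      rw [tmulVec_single] at h
      exact h
    rw [prodHomotopy_tmulVec]
    refine add_mem (tmulVec_mem ?_ (h1 b hb)
      (Finsupp.single_mem_supported K _ (Set.mem_singleton c))) ?_
    · rintro b' ⟨hb', hh⟩ c' rfl
      refine ⟨sup_le hb' hc, ?_⟩
      change X.h b' + Y.h c' = X.h b + Y.h c' + 1
      omega
    -- The term `ε b • e ⊗ s' c` has the right homological degree only for `h b = 0`; otherwise `ε b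
    -- = 0` removes it.
    · by_cases h0 : X.h b = 0
      · refine Submodule.smul_mem _ _ (tmulVec_mem ?_ h2 (h1' c hc))
        rintro b' ⟨hb', hh⟩ c' ⟨hc', hh'⟩
        refine ⟨sup_le hb' hc', ?_⟩
        change X.h b' + Y.h c' = X.h b + Y.h c + 1
        omega
      · rw [X.ε_single b h0, zero_smul]
        exact zero_mem _
  · refine tmulVec_mem ?_ h2 h2'
    rintro b' ⟨hb', hh⟩ c' ⟨hc', hh'⟩
    refine ⟨sup_le hb' hc', ?_⟩
    change X.h b' + Y.h c' = 0
    omega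
  · rintro ⟨b, c⟩ hp
    obtain ⟨hb, hc⟩ := sup_le_iff.1 hp
    -- `s` raises the homological degree by one, so it anticommutes with the sign, and the terms `s
    -- ⊗ d` cancel.
    have hsign : X.sign (s (Finsupp.single b 1)) = -s (X.sign (Finsupp.single b 1)) := by
      rw [X.sign_of_mem (Finsupp.supported_mono (fun b hb => hb.2) (h1 b hb)), sign_single,
        pow_succ, map_smul]
      simp
    suffices h : X.prodD Y (X.prodHomotopy Y s e s'
          (tmulVec (Finsupp.single b 1) (Finsupp.single c 1))) +
        X.prodHomotopy Y s e s' (X.prodD Y (tmulVec (Finsupp.single b 1) (Finsupp.single c 1))) =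
        tmulVec (Finsupp.single b 1) (Finsupp.single c 1) -
          X.prodε Y (tmulVec (Finsupp.single b 1) (Finsupp.single c 1)) • tmulVec e e' by
      rw [tmulVec_single] at h
      exact h
    rw [prodHomotopy_tmulVec, prodD_tmulVec, map_add, map_add, map_smul, prodD_tmulVec,
      prodD_tmulVec, prodHomotopy_tmulVec, prodHomotopy_tmulVec, prodε_tmulVec, ε_d, ε_sign, he,
      hs, hsign]
    -- What remains is `(b - ε b • e) ⊗ c + ε b • e ⊗ (c - ε c • e')`, in which the middle terms
    -- cancel.
    have e1 : X.d (s (Finsupp.single b 1)) =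
        Finsupp.single b 1 - X.ε (Finsupp.single b 1) • e - s (X.d (Finsupp.single b 1)) :=
      eq_sub_of_add_eq (h3 b hb)
    have e2 : Y.d (s' (Finsupp.single c 1)) =
        Finsupp.single c 1 - Y.ε (Finsupp.single c 1) • e' - s' (Y.d (Finsupp.single c 1)) :=
      eq_sub_of_add_eq (h3' c hc)
    rw [e1, e2]
    simp only [map_sub, map_neg, map_smul, map_zero, LinearMap.sub_apply, LinearMap.neg_apply,
      LinearMap.smul_apply, LinearMap.zero_apply, smul_sub, mul_smul, zero_smul, add_zero, zero_add]
    abel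
  · intro ha
    change X.prodε Y _ = 1
    rw [prodε_tmulVec, h4 ha.1, h4' ha.2, mul_one]
  · rintro ha ⟨b, c⟩ hp
    obtain ⟨hb, hc⟩ := sup_le_iff.1 hp
    change X.prodε Y (Finsupp.single (b, c) 1) = 0
    rw [← tmulVec_single b c, prodε_tmulVec]
    by_cases h : monomial a (1 : K) ∈ I
    · rw [h5' (fun h' => ha ⟨h, h'⟩) c hc, mul_zero]
    · rw [h5 h b hb, zero_mul]

end MultigradedComplex

/-! ### Construction of minimal multigraded resolutions -/

/-- Lift to `P` a basis of the image of `P` in `V ⧸ Q`. With `Q` the part coming from smaller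
multidegrees, the lifts are minimal generators. -/
lemma exists_basis_modulo {K V : Type u} [Field K] [AddCommGroup V] [Module K V]
    (P Q : Submodule K V) :
    ∃ (ι : Type u) (v : ι → V), (∀ i, v i ∈ P) ∧ P ≤ Q ⊔ Submodule.span K (Set.range v) ∧
      ∀ c : ι →₀ K, Finsupp.linearCombination K v c ∈ Q → c = 0 := by
  let b := Module.Basis.ofVectorSpace K (P.map Q.mkQ)
  have hb : ∀ i, ∃ v ∈ P, Q.mkQ v = (b i : V ⧸ Q) := fun i => (b i).2
  choose v hv hvb using hb
  have key : ∀ c, Q.mkQ (Finsupp.linearCombination K v c) =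
      (Finsupp.linearCombination K b c : P.map Q.mkQ) := by
    intro c
    rw [Finsupp.linearCombination_apply, Finsupp.linearCombination_apply, Finsupp.sum, Finsupp.sum,
      map_sum, Submodule.coe_sum]
    refine Finset.sum_congr rfl fun i _ => ?_
    rw [map_smul, hvb, Submodule.coe_smul]
  refine ⟨_, v, hv, fun x hx => ?_, fun c hc => ?_⟩
  · let y : P.map Q.mkQ := ⟨Q.mkQ x, x, hx, rfl⟩
    have h1 : Q.mkQ (Finsupp.linearCombination K v (b.repr y)) = Q.mkQ x := by
      rw [key, Module.Basis.linearCombination_repr]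
    have h2 : x - Finsupp.linearCombination K v (b.repr y) ∈ Q := by
      rw [← Submodule.Quotient.mk_eq_zero, ← Submodule.mkQ_apply, map_sub, h1, sub_self]
    rw [← sub_add_cancel x (Finsupp.linearCombination K v (b.repr y))]
    refine Submodule.add_mem_sup h2 ?_
    rw [← Finsupp.range_linearCombination]
    exact ⟨_, rfl⟩
  · have h1 := key c
    rw [Submodule.mkQ_apply, (Submodule.Quotient.mk_eq_zero Q).2 hc] at h1
    exact (linearIndependent_iff.1 b.linearIndependent) c (Subtype.ext h1.symm)

/-- A multigraded submodule of a multigraded free module with basis `B`: its component of multidegree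
`a` is given by the space `Z a` of coefficient vectors. (The multidegrees of the basis elements are
not recorded.) -/
structure MultigradedSubmodule (K : Type u) [Field K] (n : ℕ) where
  /-- the multihomogeneous basis -/
  B : Type u
  /-- the components -/
  Z : (Fin n →₀ ℕ) → Submodule K (B →₀ K)
  mono : Monotone Z

namespace MultigradedSubmodule

variable {K : Type u} [Field K] {n : ℕ} (T : MultigradedSubmodule K n)

/-- The part of multidegree `a` generated in strictly smaller multidegrees. -/
noncomputable def lower (a : Fin n →₀ ℕ) : Submodule K (T.B →₀ K) := ⨆ b : {b // b < a}, T.Z b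

/-- The index set of the minimal generators of multidegree `a`. -/
def GenAt (a : Fin n →₀ ℕ) : Type u := (exists_basis_modulo (T.Z a) (T.lower a)).choose

/-- The minimal generators of multidegree `a`. -/
noncomputable def genAt (a : Fin n →₀ ℕ) : T.GenAt a → (T.B →₀ K) :=
  (exists_basis_modulo (T.Z a) (T.lower a)).choose_spec.choose

lemma genAt_mem (a : Fin n →₀ ℕ) (i : T.GenAt a) : T.genAt a i ∈ T.Z a :=
  (exists_basis_modulo (T.Z a) (T.lower a)).choose_spec.choose_spec.1 i

lemma le_lower_sup_span (a : Fin n →₀ ℕ) :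
    T.Z a ≤ T.lower a ⊔ Submodule.span K (Set.range (T.genAt a)) :=
  (exists_basis_modulo (T.Z a) (T.lower a)).choose_spec.choose_spec.2.1

lemma eq_zero_of_mem_lower (a : Fin n →₀ ℕ) (c : T.GenAt a →₀ K)
    (hc : Finsupp.linearCombination K (T.genAt a) c ∈ T.lower a) : c = 0 :=
  (exists_basis_modulo (T.Z a) (T.lower a)).choose_spec.choose_spec.2.2 c hc

/-- The minimal generators. -/
abbrev Gen : Type u := Σ a : Fin n →₀ ℕ, T.GenAt a

/-- The minimal cover by a free module. -/
noncomputable def cover : (T.Gen →₀ K) →ₗ[K] (T.B →₀ K) :=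
  Finsupp.linearCombination K fun g => T.genAt g.1 g.2

lemma cover_single (g : T.Gen) : T.cover (Finsupp.single g 1) = T.genAt g.1 g.2 := by
  simp [cover]

lemma cover_single_mem {g : T.Gen} {a : Fin n →₀ ℕ} (h : g.1 ≤ a) :
    T.cover (Finsupp.single g 1) ∈ T.Z a := by
  rw [cover_single]
  exact T.mono h (T.genAt_mem _ _)

/-- The kernel of the minimal cover. -/
noncomputable abbrev next : MultigradedSubmodule K n where
  B := T.Gen
  Z a := LinearMap.ker T.cover ⊓ strand K Sigma.fst a
  mono := fun _ _ h => inf_le_inf_left _ (strand_mono _ h)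

/-- Well-founded induction on the multidegree replaces Nakayama's lemma: the lower part is covered
by induction, the rest by the generators of multidegree `a`. -/
lemma le_map_cover (a : Fin n →₀ ℕ) :
    T.Z a ≤ (strand K (Sigma.fst : T.Gen → _) a).map T.cover := by
  induction a using WellFoundedLT.induction with
  | ind a ih =>
    refine (T.le_lower_sup_span a).trans (sup_le (iSup_le fun b => ?_) ?_)
    · exact (ih b.1 b.2).trans (Submodule.map_mono (strand_mono _ b.2.le))
    · rw [Submodule.span_le]
      rintro _ ⟨i, rfl⟩
      exact ⟨Finsupp.single ⟨a, i⟩ 1, Finsupp.single_mem_supported K _ (le_refl a),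
        T.cover_single _⟩

lemma cover_cover (w : T.next.Gen →₀ K) : T.cover (T.next.cover w) = 0 := by
  have : T.cover ∘ₗ T.next.cover = 0 := by
    refine Finsupp.lhom_ext' fun g => LinearMap.ext_ring ?_
    exact (T.next.cover_single_mem (le_refl g.1)).1
  exact LinearMap.congr_fun this w

/-- The cover is minimal: a relation of multidegree `a` does not involve generators of
multidegree `a`. -/
lemma ne_of_mem_next {a : Fin n →₀ ℕ} {w : T.Gen →₀ K} (hw : w ∈ T.next.Z a) {g : T.Gen}
    (hg : w g ≠ 0) : g.1 ≠ a := by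
  classical
  rintro rfl
  obtain ⟨a, i⟩ := g
  obtain ⟨hk, hs⟩ := hw
  have inj : Function.Injective (Sigma.mk a : T.GenAt a → T.Gen) := sigma_mk_injective
  -- The part of the relation on generators of multidegree exactly `a`. The remaining terms map into
  -- `T.lower a`, hence so does this part, and independence modulo `T.lower a` makes it zero.
  let c : T.GenAt a →₀ K := w.comapDomain (Sigma.mk a) inj.injOn
  have h1 : w - c.mapDomain (Sigma.mk a) ∈ Finsupp.supported K K {g : T.Gen | g.1 < a} := by
    intro g hg
    rw [Finset.mem_coe, Finsupp.mem_support_iff, Finsupp.sub_apply] at hg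
    obtain ⟨a', j⟩ := g
    by_cases h : a' = a
    · subst h
      rw [Finsupp.mapDomain_apply inj] at hg
      exact absurd (sub_self _) hg
    · rw [Finsupp.mapDomain_of_notMem_range _ _ (by rintro ⟨j', hj'⟩; cases hj'; exact h rfl),
        sub_zero] at hg
      exact lt_of_le_of_ne (mem_strand.1 hs _ hg) h
  have h2 : T.cover (w - c.mapDomain (Sigma.mk a)) ∈ T.lower a :=
    map_mem_of_single (fun g hg => le_iSup (fun b : {b // b < a} => T.Z b) ⟨g.1, hg⟩
      (T.cover_single_mem (le_refl g.1))) h1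
  rw [map_sub, LinearMap.mem_ker.1 hk, zero_sub, neg_mem_iff, cover,
    Finsupp.linearCombination_mapDomain] at h2
  have h3 := T.eq_zero_of_mem_lower a c h2
  exact hg (DFunLike.congr_fun h3 i)

/-- These sections supply the contractions of the strands. They are merely `K`-linear and chosen
separately for each `a`; values outside `T.Z a` are an arbitrary linear extension. -/
lemma exists_section (a : Fin n →₀ ℕ) :
    ∃ t : (T.B →₀ K) →ₗ[K] (T.Gen →₀ K), (∀ v, t v ∈ strand K (Sigma.fst : T.Gen → _) a) ∧
      ∀ z ∈ T.Z a, T.cover (t z) = z := by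
  let b := Module.Basis.ofVectorSpace K (T.Z a)
  choose w hw hcw using fun i => T.le_map_cover a (b i).2
  obtain ⟨t, ht⟩ := LinearMap.exists_extend
    (b.constr K fun i => (⟨w i, hw i⟩ : strand K (Sigma.fst : T.Gen → _) a))
  refine ⟨(strand K (Sigma.fst : T.Gen → _) a).subtype ∘ₗ t, fun v => (t v).2, fun z hz => ?_⟩
  have h : T.cover ∘ₗ (strand K (Sigma.fst : T.Gen → _) a).subtype ∘ₗ t ∘ₗ (T.Z a).subtype =
      (T.Z a).subtype := by
    rw [ht]
    refine b.ext fun i => ?_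
    rw [LinearMap.comp_apply, LinearMap.comp_apply, Module.Basis.constr_basis]
    exact hcw i
  exact LinearMap.congr_fun h ⟨z, hz⟩

/-- The monomial ideal `I`, in the free module of rank one. -/
noncomputable abbrev ofIdeal (I : Ideal (MvPolynomial (Fin n) K)) : MultigradedSubmodule K n where
  B := PUnit
  Z a := ⨆ _ : monomial a (1 : K) ∈ I, ⊤
  mono := by
    intro a b h
    by_cases ha : monomial a (1 : K) ∈ I
    · have hb : monomial b (1 : K) ∈ I := by
        have := I.mul_mem_left (monomial (b - a) 1) ha
        rwa [monomial_mul, tsub_add_cancel_of_le h, one_mul] at this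
      simp [ha, hb]
    · simp [ha]

lemma ofIdeal_Z_of_mem {I : Ideal (MvPolynomial (Fin n) K)} {a : Fin n →₀ ℕ}
    (ha : monomial a (1 : K) ∈ I) : (ofIdeal I).Z a = ⊤ :=
  iSup_pos ha

lemma ofIdeal_Z_of_notMem {I : Ideal (MvPolynomial (Fin n) K)} {a : Fin n →₀ ℕ}
    (ha : monomial a (1 : K) ∉ I) : (ofIdeal I).Z a = ⊥ :=
  iSup_neg ha

/-- The iterated syzygies in the minimal resolution. -/
noncomputable abbrev syz (I : Ideal (MvPolynomial (Fin n) K)) (i : ℕ) : MultigradedSubmodule K n :=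
  Nat.rec (ofIdeal I) (fun _ T => T.next) i

variable (I : Ideal (MvPolynomial (Fin n) K))

/-- The basis of the minimal resolution. -/
abbrev ResBasis : Type u := Σ i : ℕ, (syz I i).Gen

/-- The inclusion of the `i`-th module into the minimal resolution. -/
noncomputable def resIncl (i : ℕ) : ((syz I i).Gen →₀ K) →ₗ[K] (ResBasis I →₀ K) :=
  Finsupp.lmapDomain K K fun g => (⟨i, g⟩ : ResBasis I)

lemma resIncl_single (i : ℕ) (g : (syz I i).Gen) :
    resIncl I i (Finsupp.single g 1) = Finsupp.single ⟨i, g⟩ 1 := by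
  simp [resIncl]

/-- A linear map on the minimal resolution, given on the modules. -/
noncomputable def resLift {M : Type*} [AddCommGroup M] [Module K M]
    (f : ∀ i, ((syz I i).Gen →₀ K) →ₗ[K] M) : (ResBasis I →₀ K) →ₗ[K] M :=
  Finsupp.linearCombination K fun p => f p.1 (Finsupp.single p.2 1)

lemma resLift_single {M : Type*} [AddCommGroup M] [Module K M]
    (f : ∀ i, ((syz I i).Gen →₀ K) →ₗ[K] M) (i : ℕ) (g : (syz I i).Gen) :
    resLift I f (Finsupp.single ⟨i, g⟩ 1) = f i (Finsupp.single g 1) := by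
  simp [resLift]

lemma resLift_resIncl {M : Type*} [AddCommGroup M] [Module K M]
    (f : ∀ i, ((syz I i).Gen →₀ K) →ₗ[K] M) (i : ℕ) (v : (syz I i).Gen →₀ K) :
    resLift I f (resIncl I i v) = f i v := by
  have : resLift I f ∘ₗ resIncl I i = f i := by
    refine Finsupp.lhom_ext' fun g => LinearMap.ext_ring ?_
    change resLift I f (resIncl I i (Finsupp.single g 1)) = f i (Finsupp.single g 1)
    rw [resIncl_single, resLift_single]
  exact LinearMap.congr_fun this v

lemma resIncl_mem (i : ℕ) {v : (syz I i).Gen →₀ K} {s : Set (syz I i).Gen} {t : Set (ResBasis I)}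
    (hv : v ∈ Finsupp.supported K K s) (h : ∀ g ∈ s, (⟨i, g⟩ : ResBasis I) ∈ t) :
    resIncl I i v ∈ Finsupp.supported K K t :=
  map_mem_of_single (fun g hg => by
    rw [resIncl_single]
    exact Finsupp.single_mem_supported K _ (h g hg)) hv

/-- The differential on the `i`-th module of the minimal resolution. -/
noncomputable def resDAt : ∀ i, ((syz I i).Gen →₀ K) →ₗ[K] (ResBasis I →₀ K)
  | 0 => 0
  | i + 1 => resIncl I i ∘ₗ (syz I (i + 1)).cover

/-- The augmentation on the `i`-th module of the minimal resolution. -/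
noncomputable def resεAt : ∀ i, ((syz I i).Gen →₀ K) →ₗ[K] K
  | 0 => Finsupp.lapply PUnit.unit ∘ₗ (ofIdeal I).cover
  | _ + 1 => 0

lemma resDAt_succ (i : ℕ) (v : (syz I (i + 1)).Gen →₀ K) :
    resDAt I (i + 1) v = resIncl I i ((syz I (i + 1)).cover v) := rfl

lemma resDAt_zero (v : (syz I 0).Gen →₀ K) : resDAt I 0 v = 0 := rfl

lemma resεAt_succ (i : ℕ) (v : (syz I (i + 1)).Gen →₀ K) : resεAt I (i + 1) v = 0 := rfl

lemma resεAt_zero (v : (syz I 0).Gen →₀ K) :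
    resεAt I 0 v = (ofIdeal I).cover v PUnit.unit := rfl

lemma res_ext {M : Type*} [AddCommGroup M] [Module K M] {f g : (ResBasis I →₀ K) →ₗ[K] M}
    (h : ∀ i b, f (Finsupp.single ⟨i, b⟩ 1) = g (Finsupp.single ⟨i, b⟩ 1)) : f = g :=
  Finsupp.lhom_ext' fun p => LinearMap.ext_ring (h p.1 p.2)

/-- The minimal multigraded free resolution. -/
noncomputable def minimalResolution : MultigradedComplex K n where
  B := ResBasis I
  h p := p.1
  deg p := p.2.1
  d := resLift I (resDAt I)
  ε := resLift I (resεAt I)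
  d_mem := by
    rintro ⟨i, g⟩
    rw [resLift_single]
    cases i with
    | zero => exact zero_mem _
    | succ i =>
      rw [resDAt_succ]
      refine resIncl_mem I i (((syz I (i + 1)).cover_single_mem (le_refl g.1)).2) ?_
      exact fun b hb => ⟨hb, rfl⟩
  d_d v := by
    have : resLift I (resDAt I) ∘ₗ resLift I (resDAt I) = 0 := res_ext I fun i b => by
      rw [LinearMap.comp_apply, resLift_single]
      cases i with
      | zero => rw [resDAt_zero, map_zero, LinearMap.zero_apply]
      | succ i =>
        rw [resDAt_succ, resLift_resIncl, LinearMap.zero_apply]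
        cases i with
        | zero => rfl
        | succ i => rw [resDAt_succ, cover_cover, map_zero]
    exact LinearMap.congr_fun this v
  ε_d v := by
    have : resLift I (resεAt I) ∘ₗ resLift I (resDAt I) = 0 := res_ext I fun i b => by
      rw [LinearMap.comp_apply, resLift_single]
      cases i with
      | zero => rw [resDAt_zero, map_zero, LinearMap.zero_apply]
      | succ i =>
        rw [resDAt_succ, resLift_resIncl, LinearMap.zero_apply]
        cases i with
        | zero => exact DFunLike.congr_fun ((ofIdeal I).cover_cover _) PUnit.unit
        | succ i => rfl
    exact LinearMap.congr_fun this v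
  ε_single := by
    rintro ⟨i, g⟩ hi
    rw [resLift_single]
    cases i with
    | zero => exact absurd rfl hi
    | succ i => rfl

lemma minimalResolution_isMinimal : (minimalResolution I).IsMinimal := by
  rintro ⟨i, g⟩ ⟨i', g'⟩ h
  change resLift I (resDAt I) (Finsupp.single ⟨i, g⟩ 1) ⟨i', g'⟩ ≠ 0 at h
  rw [resLift_single] at h
  cases i with
  | zero => exact absurd rfl h
  | succ i =>
    rw [resDAt_succ] at h
    by_cases hi : i' = i
    · subst hi
      rw [resIncl, Finsupp.lmapDomain_apply, Finsupp.mapDomain_apply (f := fun g => (⟨i', g⟩ : ResBasis I))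
        (fun _ _ e => eq_of_heq (Sigma.mk.inj e).2)] at h
      exact (syz I i').ne_of_mem_next ((syz I (i' + 1)).cover_single_mem (le_refl g.1)) h
    · refine absurd (Finsupp.mapDomain_of_notMem_range _ _ ?_) h
      rintro ⟨j, hj⟩
      exact hi (congrArg Sigma.fst hj).symm

lemma minimalResolution_resolves : (minimalResolution I).Resolves I := by
  intro a
  choose t ht hct using fun i => (syz I i).exists_section a
  -- Subtracting `t i (cover v)` from `v` leaves a syzygy, which the next section lifts. Thus `d ∘
  -- s` is `id - t ∘ cover`; in positive homological degree `s ∘ d` supplies the missing `t ∘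
  -- cover`, since `cover ∘ cover = 0`.
  let s : (ResBasis I →₀ K) →ₗ[K] (ResBasis I →₀ K) := resLift I fun i =>
    resIncl I (i + 1) ∘ₗ t (i + 1) ∘ₗ (LinearMap.id - t i ∘ₗ (syz I i).cover)
  have hs : ∀ i v, s (resIncl I i v) =
      resIncl I (i + 1) (t (i + 1) (v - t i ((syz I i).cover v))) := fun i v =>
    resLift_resIncl I _ i v
  have hZ : ∀ i (b : (syz I i).Gen), b.1 ≤ a →
      Finsupp.single b 1 - t i ((syz I i).cover (Finsupp.single b 1)) ∈ (syz I (i + 1)).Z a := by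
    intro i b hb
    constructor
    · rw [SetLike.mem_coe, LinearMap.mem_ker, map_sub,
        hct i _ ((syz I i).cover_single_mem hb), sub_self]
    · exact sub_mem (Finsupp.single_mem_supported K _ hb) (ht i _)
  -- In degree `0` the missing term `t 0 (cover b)` equals `ε b • t 0 1`, so `e` is `t 0 1`. It is a
  -- preimage of `1` when `x^a ∈ I`; otherwise `ε` vanishes on the strand and `e` plays no role.
  refine ⟨s, resIncl I 0 (t 0 (Finsupp.single PUnit.unit 1)), ?_, ?_, ?_, ?_, ?_⟩
  · rintro ⟨i, b⟩ hb
    have h := resIncl_mem I (i + 1) (ht (i + 1) (Finsupp.single b 1 -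
      t i ((syz I i).cover (Finsupp.single b 1))))
      (t := {b' | b'.2.1 ≤ a ∧ b'.1 = i + 1}) (fun g hg => ⟨hg, rfl⟩)
    rw [← hs, resIncl_single] at h
    exact h
  · exact resIncl_mem I 0 (ht 0 _) fun g hg => ⟨hg, rfl⟩
  · rintro ⟨i, b⟩ hb
    change resLift I (resDAt I) (s (Finsupp.single ⟨i, b⟩ 1)) +
      s (resLift I (resDAt I) (Finsupp.single ⟨i, b⟩ 1)) = Finsupp.single ⟨i, b⟩ 1 -
      resLift I (resεAt I) (Finsupp.single ⟨i, b⟩ 1) • resIncl I 0 (t 0 (Finsupp.single PUnit.unit 1))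
    rw [← resIncl_single, hs, resLift_resIncl, resLift_resIncl, resLift_resIncl, resDAt_succ,
      hct (i + 1) _ (hZ i b hb)]
    cases i with
    | zero =>
      rw [resDAt_zero, map_zero, add_zero, map_sub, resεAt_zero, ← map_smul, ← map_smul]
      congr 3
      refine Finsupp.ext fun x => ?_
      change _ = (ofIdeal I).cover (Finsupp.single b 1) PUnit.unit *
        (Finsupp.single PUnit.unit (1 : K) : PUnit →₀ K) PUnit.unit
      rw [Finsupp.single_eq_same, mul_one]
      rfl
    | succ i =>
      rw [resDAt_succ, hs, cover_cover, map_zero, sub_zero, ← map_add, sub_add_cancel, resεAt_succ,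
        zero_smul, sub_zero]
  · intro ha
    change resLift I (resεAt I) (resIncl I 0 (t 0 (Finsupp.single PUnit.unit 1))) = 1
    have h : (Finsupp.single PUnit.unit 1 : PUnit →₀ K) ∈ (ofIdeal I).Z a := by
      rw [ofIdeal_Z_of_mem ha]
      trivial
    rw [resLift_resIncl]
    exact (DFunLike.congr_fun (hct 0 _ h) PUnit.unit).trans Finsupp.single_eq_same
  · rintro ha ⟨i, b⟩ hb
    change resLift I (resεAt I) (Finsupp.single ⟨i, b⟩ 1) = 0
    rw [resLift_single]
    cases i with
    | zero =>
      have h := (ofIdeal I).cover_single_mem hb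
      rw [ofIdeal_Z_of_notMem ha, Submodule.mem_bot] at h
      exact DFunLike.congr_fun h PUnit.unit
    | succ i => rfl

end MultigradedSubmodule

/-! ### The bounds for the intersection -/

variable {K : Type u} [Field K] {n : ℕ} {I J : Ideal (MvPolynomial (Fin n) K)}

lemma inf_mem_iff (hI : IsMonomialIdeal I) (hJ : IsMonomialIdeal J) (f : MvPolynomial (Fin n) K) :
    f ∈ I ⊓ J ↔ ∀ m ∈ f.support, monomial m (1 : K) ∈ I ⊓ J := by
  rw [Ideal.mem_inf, hI.mem_iff, hJ.mem_iff]
  simp only [Ideal.mem_inf]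
  exact forall₂_and.symm

lemma inf_isHomogeneous (hI : IsMonomialIdeal I) (hJ : IsMonomialIdeal J) :
    letI := MvPolynomial.gradedAlgebra (σ := Fin n) (R := K)
    (I ⊓ J).IsHomogeneous (homogeneousSubmodule (Fin n) K) :=
  letI := MvPolynomial.gradedAlgebra (σ := Fin n) (R := K)
  hI.isHomogeneous.inf hJ.isHomogeneous

open MultigradedSubmodule

/-- The resolution of an intersection given by the minimal resolutions. -/
noncomputable abbrev infResolution (I J : Ideal (MvPolynomial (Fin n) K)) :
    MultigradedComplex K n :=
  (minimalResolution I).prod (minimalResolution J)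

lemma infResolution_isResolution (hI : IsMonomialIdeal I) (hJ : IsMonomialIdeal J) :
    (infResolution I J).toGraded.IsResolution (I ⊓ J) :=
  ((minimalResolution_resolves I).prod (minimalResolution_resolves J)).isResolution
    (inf_mem_iff hI hJ)

/-- A basis element in homological degree `q + 1 > p` would lie in a term that minimality forces to
be zero. -/
lemma h_le_of_projdim_le (hI : IsMonomialIdeal I) {p : ℕ} (hp : projdim I ≤ p)
    (b : (minimalResolution I).B) : (minimalResolution I).h b ≤ p := by
  by_contra! hlt
  obtain ⟨q, hq⟩ : ∃ q, (minimalResolution I).h b = q + 1 := ⟨_, (Nat.succ_pred (by omega)).symm⟩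
  have : HasProjectiveDimensionLT (ModuleCat.of (MvPolynomial (Fin n) K) I) (q + 1) := by
    rw [← hq, ← projectiveDimension_lt_iff]
    exact lt_of_le_of_lt hp (by exact_mod_cast hlt)
  exact (((minimalResolution_isMinimal I).toGraded.isEmpty
    ((minimalResolution_resolves I).isResolution hI.mem_iff) q).false ⟨b, hq⟩).elim

lemma projdim_inf_le_of_le (hI : IsMonomialIdeal I) (hJ : IsMonomialIdeal J) {p q : ℕ}
    (hp : projdim I ≤ p) (hq : projdim J ≤ q) : projdim (I ⊓ J) ≤ (p + q : ℕ) := by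
  refine (projectiveDimension_le_iff _ _).2 ?_
  have : IsEmpty ((infResolution I J).toGraded.B (p + q + 1)) := ⟨fun b => by
    have h1 := h_le_of_projdim_le hI hp b.1.1
    have h2 := h_le_of_projdim_le hJ hq b.1.2
    have h3 : (minimalResolution I).h b.1.1 + (minimalResolution J).h b.1.2 = p + q + 1 := b.2
    omega⟩
  exact (infResolution_isResolution hI hJ).hasProjectiveDimensionLT_of_isEmpty (p + q)

lemma projdim_eq_bot_iff {L : Ideal (MvPolynomial (Fin n) K)} : projdim L = ⊥ ↔ L = ⊥ := by
  rw [projdim, projectiveDimension_eq_bot_iff, ModuleCat.isZero_of_iff_subsingleton,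
    Submodule.subsingleton_iff_eq_bot]

lemma projdim_inf_le (hI : IsMonomialIdeal I) (hJ : IsMonomialIdeal J) :
    projdim (I ⊓ J) ≤ projdim I + projdim J := by
  -- Zero ideals have projective dimension `⊥`, which no natural number bound `p` can express
  -- sharply; they are settled first.
  by_cases hI0 : I = ⊥
  · rw [hI0, bot_inf_eq, projdim_eq_bot_iff.2 rfl]
    exact bot_le
  by_cases hJ0 : J = ⊥
  · rw [hJ0, inf_bot_eq, projdim_eq_bot_iff.2 rfl]
    exact bot_le
  rw [← projdim_eq_bot_iff] at hI0 hJ0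
  have key : ∀ x y : WithBot ℕ∞, x ≠ ⊥ → y ≠ ⊥ → projdim I = x → projdim J = y →
      projdim (I ⊓ J) ≤ x + y := by
    intro x y hx hy h1 h2
    induction x with
    | bot => exact absurd rfl hx
    | coe x =>
      induction y with
      | bot => exact absurd rfl hy
      | coe y =>
        induction x with
        | top => rw [← WithBot.coe_add, top_add]; exact le_top
        | coe x =>
          induction y with
          | top => rw [← WithBot.coe_add, add_top]; exact le_top
          | coe y =>
            have := projdim_inf_le_of_le hI hJ (p := x) (q := y) h1.le h2.le
            rw [Nat.cast_add] at this
            exact this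
  exact key _ _ hI0 hJ0 rfl rfl

/-- By minimality the degree of `b` is a degree in which `Tor` is nonzero, so it enters the supremum
defining `reg I`. -/
lemma degree_sub_le_reg (hI : IsMonomialIdeal I) (b : (minimalResolution I).B) :
    ((((Finsupp.degree ((minimalResolution I).deg b) : ℕ) : ℝ) : EReal)
      - (((minimalResolution I).h b : ℝ) : EReal)) ≤ reg I := by
  have h := (minimalResolution_isMinimal I).toGraded.homologyPart_ne_bot
    ((minimalResolution_resolves I).isResolution hI.mem_iff)
    (standardResolution_isResolution hI.isHomogeneous)
    (i := (minimalResolution I).h b) ⟨b, rfl⟩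
  have h1 := le_iSup (fun j : {j : ℤ // torPart I ((minimalResolution I).h b) j ≠ ⊥} =>
    (((j : ℤ) : ℝ) : EReal)) ⟨_, h⟩
  refine le_trans ?_ (le_iSup _ ((minimalResolution I).h b))
  refine EReal.sub_le_sub (le_trans (le_of_eq ?_) h1) le_rfl
  rw [EReal.coe_eq_coe_iff]
  exact (Int.cast_natCast _).symm

/-- The lcm divides the product. -/
lemma degree_sup_le (a b : Fin n →₀ ℕ) :
    Finsupp.degree (a ⊔ b) ≤ Finsupp.degree a + Finsupp.degree b := by
  rw [← map_add]
  exact Finsupp.degree_mono (sup_le le_self_add le_add_self)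

lemma reg_inf_le (hI : IsMonomialIdeal I) (hJ : IsMonomialIdeal J) :
    reg (I ⊓ J) ≤ reg I + reg J := by
  refine iSup_le fun k => ?_
  rw [EReal.sub_le_iff_le_add (Or.inl (EReal.coe_ne_bot _)) (Or.inl (EReal.coe_ne_top _))]
  refine iSup_le fun ⟨j, hj⟩ => ?_
  -- A degree of `Tor` occurs among the basis degrees of every resolution, minimal or not. The pair
  -- found here provides basis elements for both factors, so zero ideals need no separate case.
  have : ∃ b : (infResolution I J).toGraded.B k, (infResolution I J).toGraded.deg k b = j := by
    by_contra! h
    exact hj ((standardResolution_isResolution (inf_isHomogeneous hI hJ)).homologyPart_eq_bot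
      (infResolution_isResolution hI hJ) h)
  obtain ⟨⟨⟨b, c⟩, hk⟩, rfl⟩ := this
  have hk : (minimalResolution I).h b + (minimalResolution J).h c = k := hk
  have h := add_le_add (degree_sub_le_reg hI b) (degree_sub_le_reg hJ c)
  have hd := degree_sup_le ((minimalResolution I).deg b) ((minimalResolution J).deg c)
  refine le_trans ?_ (add_le_add_left h _)
  subst hk
  change ((((Finsupp.degree ((minimalResolution I).deg b ⊔ (minimalResolution J).deg c) : ℕ) : ℤ)
    : ℝ) : EReal) ≤ _
  rw [← EReal.coe_sub, ← EReal.coe_sub, ← EReal.coe_add, ← EReal.coe_add, EReal.coe_le_coe_iff]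
  have hd' : ((Finsupp.degree ((minimalResolution I).deg b ⊔ (minimalResolution J).deg c) : ℕ) : ℝ)
    ≤ (Finsupp.degree ((minimalResolution I).deg b) : ℕ) +
      (Finsupp.degree ((minimalResolution J).deg c) : ℕ) := by exact_mod_cast hd
  push_cast
  linarith

end GradedTor

theorem corollary3p3 {K : Type u} [Field K] {n : ℕ} (I J : Ideal (MvPolynomial (Fin n) K))
    (hI : GradedTor.IsMonomialIdeal I) (hJ : GradedTor.IsMonomialIdeal J) :
    GradedTor.projdim (I ⊓ J) ≤ GradedTor.projdim I + GradedTor.projdim J ∧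
      GradedTor.reg (I ⊓ J) ≤ GradedTor.reg I + GradedTor.reg J :=
  ⟨GradedTor.projdim_inf_le hI hJ, GradedTor.reg_inf_le hI hJ⟩
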